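/- Let $N\in\mathbb N$ and let $\mathbf A=(a_{ij})\in\mathbb R^{N\times N}$ be a Metzler matrix ($a_{ij}\ge 0$ for $i\ne j$) with $\mathbf A^T\mathbf 1=\mathbf 0$. Write $\mathbf y'=\mathbf A\mathbf y$ as the production-destruction system $y_i'=\sum_j p_{ij}(\mathbf y)-\sum_j d_{ij}(\mathbf y)$ with $p_{ij}(\mathbf y)=d_{ji}(\mathbf y)=a_{ij}y_j$ for $i\neq j$ and $p_{ii}=d_{ii}=0$. **The scheme.** For given coefficients and step size $\Delta t>0$, one step $\mathbf y^n\mapsto\mathbf y^{n+1}$ of SSPMPRK3($\eta_2$) is defined by $$\begin{aligned} y_i^{(1)}&=\alpha_{10}y_i^n+\beta_{10}\Delta t\Bigl(\sum_j p_{ij}(\mathbf y^n)\tfrac{y_j^{(1)}}{y_j^n}-\sum_j d_{ij}(\mathbf y^n)\tfrac{y_i^{(1)}}{y_i^n}\Bigr),\qquad \rho_i=n_1y_i^{(1)}+n_2y_i^n\Bigl(\tfrac{y_i^{(1)}}{y_i^n}\Bigr)^2,\\ y_i^{(2)}&=\alpha_{20}y_i^n+\alpha_{21}y_i^{(1)}+\Delta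 t\Bigl(\sum_j(\beta_{20}p_{ij}(\mathbf y^n)+\beta_{21}p_{ij}(\mathbf y^{(1)}))\tfrac{y_j^{(2)}}{\rho_j}-\sum_j(\beta_{20}d_{ij}(\mathbf y^n)+\beta_{21}d_{ij}(\mathbf y^{(1)}))\tfrac{y_i^{(2)}}{\rho_i}\Bigr),\\ a_i&=\eta_1y_i^n+\eta_2y_i^{(1)}+\Delta t\Bigl(\sum_j(\eta_3p_{ij}(\mathbf y^n)+\eta_4p_{ij}(\mathbf y^{(1)}))\tfrac{a_j}{(y_j^n)^{1-s}(y_j^{(1)})^s}-\sum_j(\eta_3d_{ij}(\mathbf y^n)+\eta_4d_{ij}(\mathbf y^{(1)}))\tfrac{a_i}{(y_i^n)^{1-s}(y_i^{(1)})^s}\Bigr),\\ \sigma_i&=a_i+\zeta y_i^n\tfrac{y_i^{(2)}}{\rho_i},\\ y_i^{n+1}&=\alpha_{30}y_i^n+\alpha_{31}y_i^{(1)}+\alpha_{32}y_i^{(2)}+\Delta t\Bigl(\sum_j P_{ij}\tfrac{y_j^{n+1}}{\sigma_j}-\sum_j D_{ij}\tfrac{y_i^{n+1}}{\sigma_i}\Bigr),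 \end{aligned}$$ where $P_{ij}=\beta_{30}p_{ij}(\mathbf y^n)+\beta_{31}p_{ij}(\mathbf y^{(1)})+\beta_{32}p_{ij}(\mathbf y^{(2)})$ and $D_{ij}=\beta_{30}d_{ij}(\mathbf y^n)+\beta_{31}d_{ij}(\mathbf y^{(1)})+\beta_{32}d_{ij}(\mathbf y^{(2)})$. **The coefficients.** Let $\eta_2\in[0,r_1]$, $r_1=0.37110619221712509$. The coefficients are any real numbers that agree up to $10^{-14}$ with the tabulated values $$\begin{aligned} &\alpha_{20}\approx 9.2600312554031827\cdot10^{-1},\ \alpha_{21}\approx 7.3996874459681783\cdot10^{-2},\ \alpha_{30}\approx 7.0439040373427619\cdot10^{-1},\\ &\alpha_{31}\approx 2.0662904223744017\cdot10^{-10},\ \alpha_{32}\approx 2.9560959605909481\cdot10^{-1},\ \beta_{10}\approx 4.7620819268131703\cdot10^{-1},\\ &\beta_{20}\approx 7.7545442722396801\cdot10^{-2},\ \beta_{21}\approx 5.9197500149679749\cdot10^{-1},\ \beta_{30}\approx 2.0044747790361456\cdot10^{-1},\\ &\beta_{31}\approx 6.8214380786704851\cdot10^{-10},\ \beta_{32}\approx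 5.9121918658514827\cdot10^{-1},\ \zeta\approx 0.62889380778287493358,\\ &n_1\approx 0.25690460257320105191,\ \eta_1\approx 0.37110619221712506642-\eta_2,\\ &\eta_3\approx 0.6146025595987523739-1.2832127371313151768\,\eta_2,\ \eta_4\approx 2.2248760403511226405 \end{aligned}$$ and satisfy exactly $\eta_1\ge 0$, the consistency relations $$\alpha_{10}=1,\quad n_1+n_2=1,\quad \eta_1+\eta_2+\zeta=1,\quad \alpha_{20}+\alpha_{21}=1,\quad \alpha_{30}+\alpha_{31}+\alpha_{32}=1,$$ and the order conditions (satisfied by the tabulated values up to rounding) $$b_0+b_1+b_2=1,\qquad b_1\beta_{10}+b_2c_2=\tfrac12,$$ $$\alpha_{31}\beta_{10}^2+\alpha_{32}\bigl(\alpha_{21}\beta_{10}^2+(\beta_{20}+\beta_{21})(c_2-d_\rho)\bigr)+(\beta_{30}+\beta_{31}+\beta_{32})(1-d_\sigma)=0,$$ where $c_2=\alpha_{21}\beta_{10}+\beta_{20}+\beta_{21}$, $b_0=\alpha_{31}\beta_{10}+\alpha_{32}(\alpha_{21}\beta_{10}+\beta_{20})+\beta_{30}$, $b_1=\alpha_{32}\beta_{21}+\beta_{31}$,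 $b_2=\beta_{32}$, $d_\rho=(n_1+2n_2)\beta_{10}$ and $d_\sigma=\eta_2\beta_{10}+(\eta_1+\eta_2)(\eta_3+\eta_4)+\zeta(c_2-d_\rho)$. The exponent $s$ is any number in $[5.6,5.75]$ (this interval contains, for every $\eta_2\in[0,r_1]$, the value for which the scheme is third order accurate). **Claim.** Let $\mathbf y^*>\mathbf 0$ with $\mathbf A\mathbf y^*=\mathbf 0$ be a positive steady state. Then for all $\Delta t>0$ and all $\eta_2\in[0,r_1]$ the scheme defines a map $\mathbf g\colon\mathbb R^N_{>0}\to\mathbb R^N_{>0}$ (for every $\mathbf y^n>\mathbf 0$ the step equations have exactly one result $\mathbf y^{n+1}=\mathbf g(\mathbf y^n)$, and it is positive), and $\mathbf y^*$ is a Lyapunov stable fixed point of it: $\mathbf g(\mathbf y^*)=\mathbf y^*$, and for every $\epsilon>0$ there is $\delta>0$ such that $\mathbf y^0>\mathbf 0$ and $\|\mathbf y^0-\mathbf y^*\|<\delta$ imply $\|\mathbf y^n-\mathbf y^*\|<\epsilon$ for all $n\ge 0$, where $\mathbf y^{n+1}=\mathbf g(\mathbf y^n)$. -/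

import Mathlib

/-- Coefficients of the third order strong-stability-preserving modified Patankar Runge-Kutta
scheme. -/
structure SSPMPRK3Coeffs where
  (α10 α20 α21 α30 α31 α32 : ℝ)
  (β10 β20 β21 β30 β31 β32 : ℝ)
  (n1 n2 ζ η1 η2 η3 η4 s : ℝ)

namespace SSPMPRK3Coeffs

/-- Abscissa of the second stage: `y⁽²⁾ = y + Δt * c2 * f(y) + O(Δt²)`
(the abscissa of the first stage is `β10`). -/
def c2 (P : SSPMPRK3Coeffs) : ℝ := P.α21 * P.β10 + P.β20 + P.β21

/-- First order coefficient of the weight `ρ`: `ρ = y + Δt * dρ * f(y) + O(Δt²)`. -/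
def dρ (P : SSPMPRK3Coeffs) : ℝ := (P.n1 + 2 * P.n2) * P.β10

/-- First order coefficient of the weight `σ`: `σ = y + Δt * dσ * f(y) + O(Δt²)`. -/
def dσ (P : SSPMPRK3Coeffs) : ℝ :=
  P.η2 * P.β10 + (P.η1 + P.η2) * (P.η3 + P.η4) + P.ζ * (P.c2 - P.dρ)

/-- Butcher weight of the evaluation at `yⁿ` of the underlying Runge-Kutta scheme. -/
def b0 (P : SSPMPRK3Coeffs) : ℝ :=
  P.α31 * P.β10 + P.α32 * (P.α21 * P.β10 + P.β20) + P.β30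

/-- Butcher weight of the evaluation at `y⁽¹⁾` of the underlying Runge-Kutta scheme. -/
def b1 (P : SSPMPRK3Coeffs) : ℝ := P.α32 * P.β21 + P.β31

/-- Butcher weight of the evaluation at `y⁽²⁾` of the underlying Runge-Kutta scheme. -/
def b2 (P : SSPMPRK3Coeffs) : ℝ := P.β32

/-- `P` is an exact set of SSPMPRK3(`η₂`) coefficients: every coefficient agrees with its tabulated
decimal value up to `10⁻¹⁴`, and the identities that the tabulated decimals satisfy only up to
rounding hold exactly. The exponent `s` is any number in an interval containing, for each
`η₂ ∈ [0, r₁]`, the value that makes the scheme third order accurate. -/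
structure IsSSPMPRK3 (P : SSPMPRK3Coeffs) (η₂ : ℝ) : Prop where
  α10_eq : P.α10 = 1
  α20_near : |P.α20 - 0.92600312554031827| ≤ 1 / 10 ^ 14
  α21_near : |P.α21 - 0.073996874459681783| ≤ 1 / 10 ^ 14
  α30_near : |P.α30 - 0.70439040373427619| ≤ 1 / 10 ^ 14
  α31_near : |P.α31 - 2.0662904223744017 / 10 ^ 10| ≤ 1 / 10 ^ 14
  α32_near : |P.α32 - 0.29560959605909481| ≤ 1 / 10 ^ 14
  β10_near : |P.β10 - 0.47620819268131703| ≤ 1 / 10 ^ 14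
  β20_near : |P.β20 - 0.077545442722396801| ≤ 1 / 10 ^ 14
  β21_near : |P.β21 - 0.59197500149679749| ≤ 1 / 10 ^ 14
  β30_near : |P.β30 - 0.20044747790361456| ≤ 1 / 10 ^ 14
  β31_near : |P.β31 - 6.8214380786704851 / 10 ^ 10| ≤ 1 / 10 ^ 14
  β32_near : |P.β32 - 0.59121918658514827| ≤ 1 / 10 ^ 14
  ζ_near : |P.ζ - 0.62889380778287493358| ≤ 1 / 10 ^ 14
  n1_near : |P.n1 - 0.25690460257320105191| ≤ 1 / 10 ^ 14
  η1_near : |P.η1 - (0.37110619221712506642 - η₂)| ≤ 1 / 10 ^ 14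
  η2_eq : P.η2 = η₂
  η3_near : |P.η3 - (-1.2832127371313151768 * η₂ + 0.6146025595987523739)| ≤ 1 / 10 ^ 14
  η4_near : |P.η4 - 2.2248760403511226405| ≤ 1 / 10 ^ 14
  s_mem : P.s ∈ Set.Icc 5.6 5.75
  η1_nonneg : 0 ≤ P.η1
  n_sum : P.n1 + P.n2 = 1
  η_sum : P.η1 + P.η2 + P.ζ = 1
  α2_sum : P.α20 + P.α21 = 1
  α3_sum : P.α30 + P.α31 + P.α32 = 1
  /-- order one -/
  order_one : P.b0 + P.b1 + P.b2 = 1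
  /-- order two of the underlying Runge-Kutta scheme -/
  order_two : P.b1 * P.β10 + P.b2 * P.c2 = 1 / 2
  /-- order two of the Patankar weights: their contributions of size `Δt²` cancel -/
  order_two_weights :
    P.α31 * P.β10 ^ 2 + P.α32 * (P.α21 * P.β10 ^ 2 + (P.β20 + P.β21) * (P.c2 - P.dρ)) +
      (P.β30 + P.β31 + P.β32) * (1 - P.dσ) = 0

/-- One step `y ↦ z` of the scheme with step size `Δt` for the production-destruction system
`y_i' = ∑ j, p y i j - ∑ j, d y i j`: there are stage vectors `y1`, `ρ`, `y2`, `a`, `σ` solving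
the equations of the scheme together with `z`. -/
def IsStep {ι : Type*} [Fintype ι] (P : SSPMPRK3Coeffs) (p d : (ι → ℝ) → ι → ι → ℝ) (Δt : ℝ)
    (y z : ι → ℝ) : Prop :=
  ∃ y1 ρ y2 a σ : ι → ℝ,
    (∀ i, y1 i = P.α10 * y i + P.β10 * Δt *
      (∑ j, p y i j * (y1 j / y j) - ∑ j, d y i j * (y1 i / y i))) ∧
    (∀ i, ρ i = P.n1 * y1 i + P.n2 * y i * (y1 i / y i) ^ 2) ∧
    (∀ i, y2 i = P.α20 * y i + P.α21 * y1 i + Δt *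
      (∑ j, (P.β20 * p y i j + P.β21 * p y1 i j) * (y2 j / ρ j) -
        ∑ j, (P.β20 * d y i j + P.β21 * d y1 i j) * (y2 i / ρ i))) ∧
    (∀ i, a i = P.η1 * y i + P.η2 * y1 i + Δt *
      (∑ j, (P.η3 * p y i j + P.η4 * p y1 i j) *
          (a j / (y j ^ (1 - P.s) * y1 j ^ P.s)) -
        ∑ j, (P.η3 * d y i j + P.η4 * d y1 i j) *
          (a i / (y i ^ (1 - P.s) * y1 i ^ P.s)))) ∧
    (∀ i, σ i = a i + P.ζ * y i * (y2 i / ρ i)) ∧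
    (∀ i, z i = P.α30 * y i + P.α31 * y1 i + P.α32 * y2 i + Δt *
      (∑ j, (P.β30 * p y i j + P.β31 * p y1 i j + P.β32 * p y2 i j) * (z j / σ j) -
        ∑ j, (P.β30 * d y i j + P.β31 * d y1 i j + P.β32 * d y2 i j) * (z i / σ i)))

end SSPMPRK3Coeffs

/-- Production terms `p_ij(y) = a_ij y_j` (`i ≠ j`), `p_ii = 0` of the linear system `y' = A y`. -/
def linProd {ι : Type*} [DecidableEq ι] (A : Matrix ι ι ℝ) (y : ι → ℝ) (i j : ι) : ℝ :=
  if i = j then 0 else A i j * y j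

/-- Destruction terms `d_ij(y) = p_ji(y)` of the linear system `y' = A y`. -/
def linDest {ι : Type*} [DecidableEq ι] (A : Matrix ι ι ℝ) (y : ι → ℝ) (i j : ι) : ℝ :=
  linProd A y j i

/-- `x` is a Lyapunov stable fixed point of the iteration `y ↦ g y` on `D`. -/
def IsLyapunovStableFixedPt {E : Type*} [NormedAddCommGroup E] (D : Set E) (g : E → E)
    (x : E) : Prop :=
  g x = x ∧ ∀ ε > 0, ∃ δ > 0, ∀ y ∈ D, ‖y - x‖ < δ → ∀ n : ℕ, ‖g^[n] y - x‖ < ε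

/-! With `Z = Δt • A`, every stage is a linear system `u = b + Z (D * u)` with `D ≥ 0`. Zero column
sums and nonnegative off-diagonal entries make it uniquely solvable, with a positive solution for
positive `b` (`pos_of_eq_add_mulVec`, `det_one_sub_ne_zero`). Hence the step is a map of the
positive orthant to itself, and it is differentiable at the steady state. It fixes every positive
vector of `ker Z` and preserves `Q y`, where `Q` is the projection onto `ker Z` along the range of
`Z`. This `Q` exists because `0` is a semisimple eigenvalue
(`mulVec_eq_zero_of_mulVec_mulVec_eq_zero`).

The linearization `T` at `ystar` is not a contraction: it has eigenvalue `1` on the directions of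
`ker Z`. But each nearby fibre of `Q` is invariant and contains its own fixed point `Q y`, so it
suffices that some power of `T` contracts `ker Q` (`IsLyapunovStableFixedPt.of_hasStrictFDerivAt`).

For that contraction, the derivative of each stage commutes with `Z`, and on an eigenvector of `Z`
with eigenvalue `μ` the matrix `T` acts by the scalar `R(μ)`, where `R` is the stability function.
Gershgorin's theorem puts the nonzero eigenvalues of `Z` in the open left half-plane, so the bound
needed is `|R| < 1` there (`norm_stability_lt_one`). `R` is a quotient `N / D` of quartics, and the
order conditions say that `N` agrees with `D e^z` up to `z²`. At `z = -x + i y` the difference `|D|²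
- |N|²` is then a polynomial in `x` and `y²` whose coefficients are all nonnegative and which
contains the term `2 x`. The signs are certified by interval arithmetic, uniformly in `η₂` and `s`.
-/

/-- Column sums zero, nonnegative off-diagonal. -/
structure Matrix.IsConservativeMetzler {ι : Type*} [Fintype ι] (A : Matrix ι ι ℝ) : Prop where
  offDiag_nonneg : ∀ i j, i ≠ j → 0 ≤ A i j
  col_sum : ∀ j, ∑ i, A i j = 0

/-! ### Conservative Metzler matrices: positivity and solvability -/

namespace Matrix.IsConservativeMetzler

variable {ι : Type*} [Fintype ι] {A : Matrix ι ι ℝ}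

theorem smul (hA : A.IsConservativeMetzler) {t : ℝ} (ht : 0 ≤ t) :
    (t • A).IsConservativeMetzler where
  offDiag_nonneg i j h := mul_nonneg ht (hA.offDiag_nonneg i j h)
  col_sum j := by simp [← Finset.mul_sum, hA.col_sum j]

theorem diag_nonpos (hA : A.IsConservativeMetzler) (j : ι) : A j j ≤ 0 := by
  classical
  have h := hA.col_sum j
  rw [← Finset.add_sum_erase _ _ (Finset.mem_univ j)] at h
  have : 0 ≤ ∑ i ∈ Finset.univ.erase j, A i j :=
    Finset.sum_nonneg fun i hi => hA.offDiag_nonneg i j (Finset.ne_of_mem_erase hi)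
  linarith

/-- Sum the equations over the set `s` of indices with `u i < 0`. For `j ∈ s` the partial column sum
over `s` is minus a sum of off-diagonal entries, so it is nonpositive and multiplies a nonpositive
number. For `j ∉ s` it consists of off-diagonal entries and multiplies a nonnegative number. The sum
of `u` over `s` is thus nonnegative, which forces `s` to be empty. -/
theorem nonneg_of_eq_add_mulVec (hA : A.IsConservativeMetzler) {D u b : ι → ℝ}
    (hD : ∀ i, 0 ≤ D i) (hb : ∀ i, 0 ≤ b i) (h : ∀ i, u i = b i + (A.mulVec (D * u)) i)
    (i : ι) : 0 ≤ u i := by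
  classical
  set s : Finset ι := Finset.univ.filter fun i => u i < 0 with hs
  have h1 : ∑ i ∈ s, u i = ∑ i ∈ s, b i + ∑ j, (∑ i ∈ s, A i j) * (D j * u j) := by
    rw [Finset.sum_congr rfl fun i _ => h i, Finset.sum_add_distrib]
    congr 1
    simp only [Matrix.mulVec, dotProduct, Pi.mul_apply, Finset.sum_mul]
    exact Finset.sum_comm
  have h2 : 0 ≤ ∑ j, (∑ i ∈ s, A i j) * (D j * u j) := by
    refine Finset.sum_nonneg fun j _ => ?_
    by_cases hj : u j < 0
    · refine mul_nonneg_of_nonpos_of_nonpos ?_ (mul_nonpos_of_nonneg_of_nonpos (hD j) hj.le)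
      have := hA.col_sum j
      rw [← Finset.sum_add_sum_compl s] at this
      have h3 : 0 ≤ ∑ i ∈ sᶜ, A i j := by
        refine Finset.sum_nonneg fun i hi => hA.offDiag_nonneg i j ?_
        rintro rfl
        simp [hs, hj.not_ge] at hi
      linarith
    · push Not at hj
      refine mul_nonneg (Finset.sum_nonneg fun i hi => hA.offDiag_nonneg i j ?_)
        (mul_nonneg (hD j) hj)
      rintro rfl
      simp only [hs, Finset.mem_filter] at hi
      exact absurd hi.2 hj.not_gt
  have h3 : 0 ≤ ∑ i ∈ s, b i := Finset.sum_nonneg fun i _ => hb i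
  by_contra! hi
  have h4 : ∑ i ∈ s, u i < 0 :=
    Finset.sum_neg (fun i hi => (Finset.mem_filter.1 hi).2)
      ⟨i, Finset.mem_filter.2 ⟨Finset.mem_univ _, hi⟩⟩
  linarith

/-- If `u i = 0`, the diagonal term of row `i` drops out and the remaining terms are nonnegative, so
the row would give `0 ≥ b i`. -/
theorem pos_of_eq_add_mulVec (hA : A.IsConservativeMetzler) {D u b : ι → ℝ}
    (hD : ∀ i, 0 ≤ D i) (hb : ∀ i, 0 < b i) (h : ∀ i, u i = b i + (A.mulVec (D * u)) i)
    (i : ι) : 0 < u i := by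
  classical
  have hu := hA.nonneg_of_eq_add_mulVec hD (fun i => (hb i).le) h
  have hi := h i
  simp only [Matrix.mulVec, dotProduct, Pi.mul_apply] at hi
  rw [← Finset.add_sum_erase _ _ (Finset.mem_univ i)] at hi
  have : 0 ≤ ∑ j ∈ Finset.univ.erase i, A i j * (D j * u j) :=
    Finset.sum_nonneg fun j hj => mul_nonneg
      (hA.offDiag_nonneg i j (Finset.ne_of_mem_erase hj).symm) (mul_nonneg (hD j) (hu j))
  refine lt_of_le_of_ne (hu i) fun h0 => ?_
  rw [← h0, mul_zero, mul_zero, zero_add] at hi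
  linarith [hb i]

/-- A kernel vector `v` solves the system with `b = 0`, and so does `-v`; both are nonnegative, so
`v = 0`. -/
theorem det_one_sub_ne_zero [DecidableEq ι] (hA : A.IsConservativeMetzler) {D : ι → ℝ}
    (hD : ∀ i, 0 ≤ D i) : (1 - A * Matrix.diagonal D).det ≠ 0 := by
  intro h
  obtain ⟨v, hv, hv0⟩ := Matrix.exists_mulVec_eq_zero_iff.2 h
  have key : ∀ v, (1 - A * Matrix.diagonal D).mulVec v = 0 → ∀ i, 0 ≤ v i := by
    intro v hv
    refine hA.nonneg_of_eq_add_mulVec (b := 0) hD (fun _ => le_rfl) fun i => ?_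
    have := congrFun hv i
    rw [Matrix.sub_mulVec, Matrix.one_mulVec, ← Matrix.mulVec_mulVec] at this
    have h2 : (Matrix.diagonal D).mulVec v = D * v := by
      ext i; simp [Matrix.mulVec_diagonal]
    rw [h2] at this
    simp at this ⊢
    linarith
  apply hv
  ext i
  have h1 := key v hv0 i
  have h2 := key (-v) (by rw [Matrix.mulVec_neg, hv0, neg_zero]) i
  simp at h2 ⊢
  linarith

end Matrix.IsConservativeMetzler

/-! ### The linear system of a Patankar stage and its dependence on the data -/

/-- The solution `u` of `u = b + A (D * u)`. -/
noncomputable def patankarSolve {ι : Type*} [Fintype ι] [DecidableEq ι] (A : Matrix ι ι ℝ)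
    (D b : ι → ℝ) : ι → ℝ :=
  (1 - A * Matrix.diagonal D)⁻¹.mulVec b

section patankarSolve

variable {ι : Type*} [Fintype ι] [DecidableEq ι] {A : Matrix ι ι ℝ} {D b u : ι → ℝ}

theorem patankarSolve_unique (h : (1 - A * Matrix.diagonal D).det ≠ 0) :
    u = patankarSolve A D b ↔ u = b + A.mulVec (D * u) := by
  have h2 : A.mulVec (D * u) = (A * Matrix.diagonal D).mulVec u := by
    rw [← Matrix.mulVec_mulVec]; congr 1; ext i; simp [Matrix.mulVec_diagonal]
  have h3 : u = b + A.mulVec (D * u) ↔ (1 - A * Matrix.diagonal D).mulVec u = b := by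
    rw [h2, Matrix.sub_mulVec, Matrix.one_mulVec, sub_eq_iff_eq_add]
  rw [h3, patankarSolve]
  have hu : IsUnit (1 - A * Matrix.diagonal D).det := isUnit_iff_ne_zero.2 h
  constructor
  · rintro rfl
    rw [Matrix.mulVec_mulVec, Matrix.mul_nonsing_inv _ hu, Matrix.one_mulVec]
  · rintro rfl
    rw [Matrix.mulVec_mulVec, Matrix.nonsing_inv_mul _ hu, Matrix.one_mulVec]

theorem patankarSolve_eq (h : (1 - A * Matrix.diagonal D).det ≠ 0) :
    patankarSolve A D b = b + A.mulVec (D * patankarSolve A D b) :=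
  (patankarSolve_unique h).1 rfl

theorem patankarSolve_pos (hA : A.IsConservativeMetzler) (hD : ∀ i, 0 ≤ D i)
    (hb : ∀ i, 0 < b i) (i : ι) : 0 < patankarSolve A D b i :=
  hA.pos_of_eq_add_mulVec hD hb
    (fun i => congrFun (patankarSolve_eq (hA.det_one_sub_ne_zero hD)) i) i

/-- By Cramer's rule each component is a quotient of two determinants that are polynomial in `D` and
`b`. -/
theorem contDiffAt_patankarSolve (h : (1 - A * Matrix.diagonal D).det ≠ 0) :
    ContDiffAt ℝ 1 (fun q : (ι → ℝ) × (ι → ℝ) => patankarSolve A q.1 q.2) (D, b) := by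
  have hdet : ∀ M : (ι → ℝ) × (ι → ℝ) → Matrix ι ι ℝ,
      (∀ i j, ContDiff ℝ 1 fun q => M q i j) → ContDiff ℝ 1 fun q => (M q).det := by
    intro M hM
    simp only [Matrix.det_apply]
    refine ContDiff.sum fun σ _ => ContDiff.const_smul _ (contDiff_prod fun i _ => hM _ _)
  have hM : ∀ i j, ContDiff ℝ 1 fun q : (ι → ℝ) × (ι → ℝ) =>
      (1 - A * Matrix.diagonal q.1) i j := by
    intro i j
    simp only [Matrix.sub_apply, Matrix.mul_diagonal]
    fun_prop
  rw [contDiffAt_pi]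
  intro i
  have : ∀ q : (ι → ℝ) × (ι → ℝ), patankarSolve A q.1 q.2 i =
      ((1 - A * Matrix.diagonal q.1).det)⁻¹ *
        ((1 - A * Matrix.diagonal q.1).updateCol i q.2).det := by
    intro q
    rw [patankarSolve, Matrix.inv_def, Matrix.smul_mulVec, ← Matrix.cramer_eq_adjugate_mulVec,
      Pi.smul_apply, Matrix.cramer_apply, Ring.inverse_eq_inv', smul_eq_mul]
  simp only [this]
  refine ContDiffAt.mul (ContDiffAt.inv (hdet _ hM).contDiffAt h) (hdet _ fun k l => ?_).contDiffAt
  by_cases hl : l = i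
  · subst hl; simp only [Matrix.updateCol_self]; fun_prop
  · simp only [Matrix.updateCol_ne hl]; exact hM k l

/-- Implicit differentiation of `u = b + A (D * u)`. -/
theorem exists_hasStrictFDerivAt_patankarSolve {E : Type*} [NormedAddCommGroup E]
    [NormedSpace ℝ E] {D b : E → ι → ℝ} {D' b' : E →L[ℝ] ι → ℝ} {x : E}
    (hD : HasStrictFDerivAt D D' x) (hb : HasStrictFDerivAt b b' x)
    (h : (1 - A * Matrix.diagonal (D x)).det ≠ 0) :
    ∃ u' : E →L[ℝ] ι → ℝ, HasStrictFDerivAt (fun y => patankarSolve A (D y) (b y)) u' x ∧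
      ∀ v, u' v = b' v + A.mulVec (D x * u' v + D' v * patankarSolve A (D x) (b x)) := by
  have h1 := ((contDiffAt_patankarSolve (b := b x) h).hasStrictFDerivAt one_ne_zero).comp x
    (hD.prodMk hb)
  refine ⟨_, h1, fun v => ?_⟩
  set u' := (fderiv ℝ (fun q : (ι → ℝ) × (ι → ℝ) => patankarSolve A q.1 q.2) (D x, b x)).comp
    (D'.prod b')
  -- The determinant stays nonzero near `x`, so the defining equation holds on a neighbourhood and
  -- may be differentiated; uniqueness of the derivative then gives the formula.
  have hev : ∀ᶠ y in nhds x, patankarSolve A (D y) (b y) =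
      b y + A.mulVecLin.toContinuousLinearMap (D y * patankarSolve A (D y) (b y)) := by
    have hc : Continuous fun d : ι → ℝ => (1 - A * Matrix.diagonal d).det := by
      refine Continuous.matrix_det (continuous_matrix fun i j => ?_)
      simp only [Matrix.sub_apply, Matrix.mul_diagonal]
      fun_prop
    have := (hc.continuousAt.comp hD.continuousAt).eventually_ne h
    filter_upwards [this] with y hy
    exact patankarSolve_eq hy
  have h2 := (hb.hasFDerivAt.add ((A.mulVecLin.toContinuousLinearMap).hasFDerivAt.comp x
    (hD.hasFDerivAt.mul h1.hasFDerivAt))).congr_of_eventuallyEq hev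
  have h3 := congrArg (fun L : E →L[ℝ] ι → ℝ => L v) (h1.hasFDerivAt.unique h2)
  simp only [] at h3
  refine h3.trans ?_
  simp [Matrix.mulVec_add, mul_comm]

end patankarSolve


/-! ### A stability criterion for maps with invariant fibres -/

open Filter Topology in
/-- Lyapunov stability of a fixed point `x` of `g` all of whose neighbouring points are moved
towards their own fixed point `Π y`: no centre manifold is needed since the fibres of `Π` are
invariant. -/
theorem IsLyapunovStableFixedPt.of_hasStrictFDerivAt {E : Type*} [NormedAddCommGroup E]
    [NormedSpace ℝ E] {D : Set E} {g : E → E} {x : E} {T Q : E →L[ℝ] E}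
    (hD : D ∈ 𝓝 x) (hmaps : Set.MapsTo g D D) (hT : HasStrictFDerivAt g T x) (hx : Q x = x)
    (hQQ : ∀ y, Q (Q y) = Q y) (hQ : ∀ y ∈ D, Q (g y) = Q y)
    (hfix : ∀ y ∈ D, Q y = y → g y = y)
    {k : ℕ} (hk : ∀ v, Q v = 0 → ‖(T ^ k) v‖ ≤ 1 / 2 * ‖v‖) :
    IsLyapunovStableFixedPt D g x := by
  have hgx : g x = x := hfix x (mem_of_mem_nhds hD) hx
  rcases Nat.eq_zero_or_pos k with rfl | hkpos
  · -- `T ^ 0 = 1` forces `Q` to be the identity.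
    have hid : ∀ v, Q v = v := by
      intro v
      have := hk (v - Q v) (by rw [map_sub, hQQ, sub_self])
      have h2 : ‖v - Q v‖ ≤ 0 := by simp at this; linarith [norm_nonneg (v - Q v)]
      exact (sub_eq_zero.1 (norm_le_zero_iff.1 h2)).symm
    refine ⟨hgx, fun ε hε => ⟨ε, hε, fun y hy hyx n => ?_⟩⟩
    rwa [Function.iterate_fixed (hfix y hy (hid y))]
  have hitD : ∀ n, Set.MapsTo g^[n] D D := fun n => hmaps.iterate n
  have hQit : ∀ n, ∀ y ∈ D, Q (g^[n] y) = Q y := by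
    intro n
    induction n with
    | zero => intro y _; rfl
    | succ n ih => intro y hy; rw [Function.iterate_succ_apply', hQ _ (hitD n hy), ih y hy]
  have hfk : HasStrictFDerivAt g^[k] (T ^ k) x := hT.iterate hgx k
  -- Any error below `1 / 2` would do: with the factor `1 / 2` of `T ^ k` on `ker Q`, the total
  -- factor `3 / 4` is at most one. Strict differentiability is needed because the two points
  -- compared, `y` and `Q y`, both differ from `x` in general.
  obtain ⟨U, hU, hlip⟩ := hfk.approximates_deriv_on_nhds (c := 1 / 4) (Or.inr (by norm_num))
  obtain ⟨r, hr, hball⟩ := Metric.mem_nhds_iff.1 (inter_mem hU hD)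
  -- contraction towards `Q y`
  have hcontr : ∀ y ∈ Metric.ball x r, Q y ∈ Metric.ball x r →
      ‖g^[k] y - Q y‖ ≤ ‖y - Q y‖ := by
    intro y hy hQy
    have h1 := hlip y (hball hy).1 (Q y) (hball hQy).1
    have h2 : g^[k] (Q y) = Q y :=
      Function.iterate_fixed (hfix _ (hball hQy).2 (hQQ y)) k
    rw [h2] at h1
    have h3 := hk (y - Q y) (by rw [map_sub, hQQ, sub_self])
    have h4 : ‖g^[k] y - Q y‖ ≤ ‖g^[k] y - Q y - (T ^ k) (y - Q y)‖ + ‖(T ^ k) (y - Q y)‖ := by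
      simpa using norm_add_le (g^[k] y - Q y - (T ^ k) (y - Q y)) ((T ^ k) (y - Q y))
    have h5 : ((1 / 4 : NNReal) : ℝ) = 1 / 4 := by norm_num
    rw [h5] at h1
    linarith [norm_nonneg (y - Q y)]
  -- From `‖z - x‖ ≤ ‖y - Q y‖ + ‖Q y - x‖ ≤ ‖y - x‖ + 2 ‖Q y - x‖` for points `z` no farther from
  -- `Q y` than `y` is.
  set M : ℝ := 1 + 2 * ‖Q‖ with hM
  have hM1 : 1 ≤ M := by linarith [norm_nonneg Q]
  have hQx : ∀ y, ‖Q y - x‖ ≤ ‖Q‖ * ‖y - x‖ := by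
    intro y
    have := Q.le_opNorm (y - x)
    rwa [map_sub, hx] at this
  have hstab : ∀ y, M * ‖y - x‖ < r → ∀ m : ℕ, ‖(g^[k])^[m] y - x‖ ≤ M * ‖y - x‖ := by
    intro y hy m
    have hQy : Q y ∈ Metric.ball x r := by
      rw [Metric.mem_ball, dist_eq_norm]
      have := hQx y
      nlinarith [norm_nonneg (y - x), norm_nonneg Q]
    have hyD : y ∈ D := by
      refine (hball ?_).2
      rw [Metric.mem_ball, dist_eq_norm]
      nlinarith [norm_nonneg (y - x)]
    have hbd : ∀ z, ‖z - Q y‖ ≤ ‖y - Q y‖ → ‖z - x‖ ≤ M * ‖y - x‖ := by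
      intro z hz
      have h1 : ‖z - x‖ ≤ ‖z - Q y‖ + ‖Q y - x‖ := norm_sub_le_norm_sub_add_norm_sub _ _ _
      have h2 : ‖y - Q y‖ ≤ ‖y - x‖ + ‖Q y - x‖ := by
        rw [norm_sub_rev (Q y) x]; exact norm_sub_le_norm_sub_add_norm_sub _ _ _
      have := hQx y
      rw [hM]
      linarith
    refine hbd _ ?_
    induction m with
    | zero => exact le_rfl
    | succ m ih =>
      rw [Function.iterate_succ_apply']
      have h1 : Q ((g^[k])^[m] y) = Q y := by rw [← Function.iterate_mul]; exact hQit _ _ hyD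
      have h2 := hcontr ((g^[k])^[m] y)
        (by rw [Metric.mem_ball, dist_eq_norm]; exact (hbd _ ih).trans_lt hy) (by rwa [h1])
      rw [h1] at h2
      exact h2.trans ih
  refine ⟨hgx, fun ε hε => ?_⟩
  have hcont : ∀ j : ℕ, ∀ᶠ y in 𝓝 x, ‖g^[j] y - x‖ < ε := by
    intro j
    have h1 := (hT.iterate hgx j).continuousAt
    have h2 : g^[j] x = x := Function.iterate_fixed hgx j
    have h3 := h1.tendsto
    rw [h2] at h3
    simpa [dist_eq_norm] using Metric.tendsto_nhds.1 h3 ε hε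
  obtain ⟨r', hr', hball'⟩ := Metric.eventually_nhds_iff.1
    ((Finset.range k).eventually_all.2 fun j _ => hcont j)
  refine ⟨min r r' / M, div_pos (lt_min hr hr') (by linarith), fun y _ hyx n => ?_⟩
  rw [lt_div_iff₀ (by linarith), mul_comm] at hyx
  -- Multiples of `k` are controlled by `hstab`; the fewer than `k` remaining iterations are
  -- controlled by continuity at `x`.
  rw [← Nat.mod_add_div n k, Function.iterate_add_apply, Function.iterate_mul]
  refine hball' ?_ (n % k) (Finset.mem_range.2 (Nat.mod_lt _ hkpos))
  rw [dist_eq_norm]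
  exact (hstab y (hyx.trans_le (min_le_left _ _)) _).trans_lt (hyx.trans_le (min_le_right _ _))


/-! ### Spectral theory of conservative Metzler matrices -/

namespace Matrix

variable {ι : Type*} [Fintype ι]

/-- The imaginary axis meets the spectrum of a conservative Metzler matrix only in `0`. -/
theorem IsConservativeMetzler.re_eigenvalue_neg [DecidableEq ι] {A : Matrix ι ι ℝ}
    (hA : A.IsConservativeMetzler) {μ : ℂ} {w : ι → ℂ} (hw : w ≠ 0)
    (h : (A.map Complex.ofReal).mulVec w = μ • w) (hμ : μ ≠ 0) : μ.re < 0 := by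
  have hev : Module.End.HasEigenvalue (Matrix.toLin' (A.map Complex.ofReal).transpose) μ := by
    have h1 : (Matrix.diagonal (fun _ => μ) - A.map Complex.ofReal).det = 0 :=
      Matrix.exists_mulVec_eq_zero_iff.1 ⟨w, hw, by
        rw [Matrix.sub_mulVec, h]; ext i; simp⟩
    rw [← Matrix.det_transpose] at h1
    obtain ⟨v, hv, hv0⟩ := Matrix.exists_mulVec_eq_zero_iff.2 h1
    rw [Matrix.transpose_sub, Matrix.diagonal_transpose, Matrix.sub_mulVec, sub_eq_zero] at hv0
    refine Module.End.hasEigenvalue_of_hasEigenvector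
      (Module.End.hasEigenvector_iff.2 ⟨Module.End.mem_eigenspace_iff.2 ?_, hv⟩)
    rw [Matrix.toLin'_apply, ← hv0]
    ext i; simp [Matrix.mulVec_diagonal]
  -- Gershgorin's discs are taken for the transpose, since it is the columns that sum to zero: the
  -- disc about `A k k ≤ 0` has radius `-A k k` and meets the closed right half-plane only in `0`.
  obtain ⟨k, hk⟩ := eigenvalue_mem_ball hev
  have hsum : ∑ j ∈ Finset.univ.erase k, ‖(A.map Complex.ofReal).transpose k j‖ = -A k k := by
    have := hA.col_sum k
    rw [← Finset.add_sum_erase _ _ (Finset.mem_univ k)] at this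
    rw [neg_eq_of_add_eq_zero_right this]
    refine Finset.sum_congr rfl fun j hj => ?_
    simp [abs_of_nonneg (hA.offDiag_nonneg j k (Finset.ne_of_mem_erase hj))]
  rw [hsum, Metric.mem_closedBall, dist_eq_norm] at hk
  have h2 : ‖μ - (A k k : ℝ)‖ ^ 2 ≤ (A k k) ^ 2 := by
    have h3 : ‖μ - (A k k : ℝ)‖ ≤ -A k k := by simpa using hk
    nlinarith [norm_nonneg (μ - (A k k : ℝ))]
  rw [← Complex.normSq_eq_norm_sq, Complex.normSq_apply] at h2
  simp at h2
  have h4 := hA.diag_nonpos k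
  by_contra! hre
  have h5 : μ.re * μ.re + μ.im * μ.im ≤ 2 * (A k k * μ.re) := by nlinarith
  have h6 : A k k * μ.re ≤ 0 := mul_nonpos_of_nonpos_of_nonneg h4 hre
  apply hμ
  apply Complex.ext <;> simp <;> nlinarith [mul_self_nonneg μ.re, mul_self_nonneg μ.im]

/-- The eigenvalue `0` is semisimple; irreducibility is not needed. Write `k = A u` and `w = k / y`.
Since `A y = 0`, `A k = 0` and the columns sum to zero, the Dirichlet form `∑ A i j * y j * (w i - w
j) ^ 2` vanishes. Its terms are nonnegative, so `w i = w j` whenever `A i j ≠ 0`. Then `∑ y i * w i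
^ 2 = ∑ w i * (A u) i = ∑ w j * u j * (column sum) = 0`, hence `w = 0`. -/
theorem IsConservativeMetzler.mulVec_eq_zero_of_mulVec_mulVec_eq_zero {A : Matrix ι ι ℝ}
    (hA : A.IsConservativeMetzler) {y : ι → ℝ} (hy : ∀ i, 0 < y i) (hAy : A.mulVec y = 0)
    {u : ι → ℝ} (hu : A.mulVec (A.mulVec u) = 0) : A.mulVec u = 0 := by
  classical
  set k := A.mulVec u with hk
  set w : ι → ℝ := fun i => k i / y i with hw
  have hkw : ∀ i, k i = y i * w i := fun i => by simp [hw, mul_div_cancel₀ _ (hy i).ne']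
  have hrow : ∀ i, ∑ j, A i j * y j = 0 := fun i => congrFun hAy i
  have hrow2 : ∀ i, ∑ j, A i j * (y j * w j) = 0 := fun i => by
    simpa [Matrix.mulVec, dotProduct, hkw] using congrFun hu i
  -- the Dirichlet form of `w` vanishes
  have hdir : ∑ i, ∑ j, A i j * y j * (w i - w j) ^ 2 = 0 := by
    have e1 : ∑ i, ∑ j, A i j * y j * (w i - w j) ^ 2 =
        ∑ i, w i ^ 2 * ∑ j, A i j * y j - 2 * ∑ i, w i * ∑ j, A i j * (y j * w j)
          + ∑ j, y j * w j ^ 2 * ∑ i, A i j := by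
      simp only [Finset.mul_sum]
      rw [Finset.sum_comm (f := fun j i => y j * w j ^ 2 * A i j), ← Finset.sum_sub_distrib,
        ← Finset.sum_add_distrib]
      refine Finset.sum_congr rfl fun i _ => ?_
      rw [← Finset.sum_sub_distrib, ← Finset.sum_add_distrib]
      exact Finset.sum_congr rfl fun j _ => by ring
    rw [e1]
    simp [hrow, hrow2, hA.col_sum]
  have hnn : ∀ i j, 0 ≤ A i j * y j * (w i - w j) ^ 2 := by
    intro i j
    by_cases hij : i = j
    · simp [hij]
    · exact mul_nonneg (mul_nonneg (hA.offDiag_nonneg i j hij) (hy j).le) (sq_nonneg _)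
  have hconst : ∀ i j, A i j * w i = A i j * w j := by
    intro i j
    have h1 := (Finset.sum_eq_zero_iff_of_nonneg fun i _ => Finset.sum_nonneg fun j _ => hnn i j).1
      hdir i (Finset.mem_univ i)
    have h2 := (Finset.sum_eq_zero_iff_of_nonneg fun j _ => hnn i j).1 h1 j (Finset.mem_univ j)
    rcases mul_eq_zero.1 h2 with h3 | h3
    · rcases mul_eq_zero.1 h3 with h4 | h4
      · simp [h4]
      · exact absurd h4 (hy j).ne'
    · rw [sub_eq_zero.1 (pow_eq_zero_iff two_ne_zero |>.1 h3)]
  have hzero : ∑ i, y i * w i ^ 2 = 0 := by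
    have e1 : ∑ i, y i * w i ^ 2 = ∑ i, w i * ∑ j, A i j * u j := by
      refine Finset.sum_congr rfl fun i _ => ?_
      have : ∑ j, A i j * u j = k i := rfl
      rw [this, hkw]; ring
    rw [e1]
    simp only [Finset.mul_sum]
    rw [Finset.sum_comm]
    refine Finset.sum_eq_zero fun j _ => ?_
    have : ∀ i, w i * (A i j * u j) = w j * u j * A i j := fun i => by
      linear_combination u j * hconst i j
    simp [this, ← Finset.mul_sum, hA.col_sum]
  ext i
  have h1 := (Finset.sum_eq_zero_iff_of_nonneg
    fun i _ => mul_nonneg (hy i).le (sq_nonneg (w i))).1 hzero i (Finset.mem_univ i)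
  have h2 : w i = 0 := by
    rcases mul_eq_zero.1 h1 with h | h
    · exact absurd h (hy i).ne'
    · exact pow_eq_zero_iff two_ne_zero |>.1 h
  rw [hkw, h2]; simp

/-- The projection onto the kernel along the range. -/
theorem exists_projection_ker [DecidableEq ι] {A : Matrix ι ι ℝ}
    (h : ∀ u, A.mulVec (A.mulVec u) = 0 → A.mulVec u = 0) :
    ∃ Q : Matrix ι ι ℝ, (∀ v, A.mulVec v = 0 → Q.mulVec v = v) ∧ A * Q = 0 ∧ Q * A = 0 := by
  set f := Matrix.toLin' A with hf
  have hfa : ∀ v, f v = A.mulVec v := fun v => by simp [hf]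
  -- Fitting decomposition. The exponent `n + 1` is used so that the power is positive; by
  -- hypothesis its kernel is then that of `f` itself.
  obtain ⟨n, hn⟩ := Filter.eventually_atTop.1 f.eventually_isCompl_ker_pow_range_pow
  replace hn := hn (n + 1) (Nat.le_succ n)
  have hker : ∀ n : ℕ, ∀ v, (f ^ (n + 1)) v = 0 → f v = 0 := by
    intro n
    induction n with
    | zero => intro v hv; simpa using hv
    | succ n ih =>
      intro v hv
      rw [pow_succ, Module.End.mul_apply] at hv
      have := ih _ hv
      rw [hfa, hfa] at this
      rw [hfa]; exact h v this
  set q := (LinearMap.ker (f ^ (n + 1))).projection (LinearMap.range (f ^ (n + 1))) hn with hq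
  refine ⟨LinearMap.toMatrix' q, fun v hv => ?_, ?_, ?_⟩
  · rw [← Matrix.toLin'_apply, Matrix.toLin'_toMatrix']
    refine Submodule.projection_apply_left hn ⟨v, ?_⟩
    rw [LinearMap.mem_ker, pow_succ, Module.End.mul_apply, hfa, hv, map_zero]
  · apply Matrix.toLin'.injective
    rw [Matrix.toLin'_mul, Matrix.toLin'_toMatrix']
    refine LinearMap.ext fun v => ?_
    rw [map_zero, LinearMap.comp_apply, LinearMap.zero_apply]
    exact hker n (q v) (LinearMap.mem_ker.1 (Submodule.projection_apply_mem hn v))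
  · apply Matrix.toLin'.injective
    rw [Matrix.toLin'_mul, Matrix.toLin'_toMatrix']
    refine LinearMap.ext fun v => ?_
    have h1 : f v = f (v - q v) := by
      rw [map_sub, hker n (q v) (LinearMap.mem_ker.1 (Submodule.projection_apply_mem hn v)),
        sub_zero]
    have h2 : q (v - q v) = 0 := by
      rw [map_sub, sub_eq_zero]
      exact (Submodule.projection_apply_left hn ⟨q v, Submodule.projection_apply_mem hn v⟩).symm
    obtain ⟨s, hs⟩ := (Submodule.projection_apply_eq_zero_iff hn).1 h2
    rw [map_zero, LinearMap.comp_apply, LinearMap.zero_apply, ← hf, h1, ← hs]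
    refine (Submodule.projection_apply_eq_zero_iff hn).2 ⟨f s, ?_⟩
    rw [← Module.End.mul_apply, ← pow_succ, pow_succ', Module.End.mul_apply]

theorem map_ofReal_mulVec (M : Matrix ι ι ℝ) (u v : ι → ℝ) :
    (M.map Complex.ofReal).mulVec (fun i => (u i : ℂ) + v i * Complex.I) =
      fun i => ((M.mulVec u i : ℝ) : ℂ) + (M.mulVec v i : ℝ) * Complex.I := by
  ext i
  simp only [Matrix.mulVec, dotProduct, Matrix.map_apply, Complex.ofReal_sum, Complex.ofReal_mul,
    Finset.sum_mul, ← Finset.sum_add_distrib]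
  exact Finset.sum_congr rfl fun j _ => by ring

section spectral

variable [DecidableEq ι]

attribute [local instance] Matrix.linftyOpNormedRing Matrix.linftyOpNormedAlgebra

/-- Powers of a matrix all of whose eigenvalues lie in the open unit disc tend to zero. -/
theorem tendsto_pow_zero_of_eigenvalues {S : Matrix ι ι ℂ}
    (h : ∀ (μ : ℂ) (w : ι → ℂ), w ≠ 0 → S.mulVec w = μ • w → ‖μ‖ < 1) :
    Filter.Tendsto (fun k : ℕ => S ^ k) Filter.atTop (nhds 0) := by
  have hcomplete : CompleteSpace (Matrix ι ι ℂ) := FiniteDimensional.complete ℂ _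
  have hspec : ∀ μ ∈ spectrum ℂ S, ‖μ‖ < 1 := by
    intro μ hμ
    rw [← Matrix.spectrum_toLin', ← Module.End.hasEigenvalue_iff_mem_spectrum] at hμ
    obtain ⟨w, hw⟩ := hμ.exists_hasEigenvector
    exact h μ w hw.2 (by simpa using hw.apply_eq_smul)
  have hr : spectralRadius ℂ S < 1 := by
    rcases subsingleton_or_nontrivial (Matrix ι ι ℂ) with hs | hn
    · simp [spectralRadius, spectrum.of_subsingleton]
    · exact spectrum.spectralRadius_lt_of_forall_lt S fun μ hμ => by
        simpa [← NNReal.coe_lt_coe] using hspec μ hμ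
  obtain ⟨c, hc1, hc2⟩ := exists_between hr
  -- Gelfand's formula: for `c` strictly between the spectral radius and `1`, eventually `‖S ^ k‖ ≤
  -- c ^ k`.
  have hG := spectrum.pow_nnnorm_pow_one_div_tendsto_nhds_spectralRadius S
  have hev := hG.eventually (gt_mem_nhds hc1)
  lift c to NNReal using (hc2.trans_le le_top).ne
  have hc2' : c < 1 := by exact_mod_cast hc2
  refine squeeze_zero_norm' ?_ (tendsto_pow_atTop_nhds_zero_of_lt_one c.2 hc2')
  filter_upwards [hev, Filter.eventually_gt_atTop 0] with k hk hk0
  have h1 : ((‖S ^ k‖₊ : ENNReal) ^ (1 / k : ℝ)) ^ (k : ℝ) ≤ (c : ENNReal) ^ (k : ℝ) :=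
    ENNReal.rpow_le_rpow hk.le (Nat.cast_nonneg k)
  rw [← ENNReal.rpow_mul, one_div_mul_cancel (by positivity), ENNReal.rpow_one,
    ENNReal.rpow_natCast] at h1
  exact_mod_cast h1

/-- If `T` commutes with the conservative Metzler matrix `Z` and acts with modulus `< 1` on the
eigenvectors of `Z` of nonzero eigenvalue, then some power of `T` is a contraction on the
complement of the kernel of `Z`. -/
theorem IsConservativeMetzler.exists_pow_contraction {Z T Q : Matrix ι ι ℝ}
    (hZ : Z.IsConservativeMetzler) (hQ : ∀ v, Z.mulVec v = 0 → Q.mulVec v = v)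
    (hZQ : Z * Q = 0) (hQZ : Q * Z = 0) (hTZ : Commute T Z) (hTQ : Commute T Q)
    (hT : ∀ (μ : ℂ) (w : ι → ℂ), w ≠ 0 → μ.re < 0 → (Z.map Complex.ofReal).mulVec w = μ • w →
      ∃ τ : ℂ, ‖τ‖ < 1 ∧ (T.map Complex.ofReal).mulVec w = τ • w) :
    ∃ k : ℕ, ∀ v, Q.mulVec v = 0 → ‖(T ^ k).mulVec v‖ ≤ 1 / 2 * ‖v‖ := by
  have hQQ : Q * Q = Q := by
    refine Matrix.mulVec_injective (funext fun v => ?_)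
    rw [← Matrix.mulVec_mulVec]
    exact hQ _ (by rw [Matrix.mulVec_mulVec, hZQ, Matrix.zero_mulVec])
  set F : Matrix ι ι ℝ →+* Matrix ι ι ℂ := Complex.ofRealHom.mapMatrix with hF
  have hFm : ∀ M : Matrix ι ι ℝ, F M = M.map Complex.ofReal := fun M => rfl
  -- `S` agrees with `T` on `ker Q` and kills the range of `Q`, where `T` need not contract. It
  -- remains to show that all eigenvalues of `S` have modulus below one.
  set S := T * (1 - Q) with hS
  have hkerC : ∀ w : ι → ℂ, (F Z).mulVec w = 0 → (F Q).mulVec w = w := by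
    intro w hw
    have hw2 : w = fun i => (((fun i => (w i).re) i : ℝ) : ℂ) +
        ((fun i => (w i).im) i : ℝ) * Complex.I := funext fun i => (Complex.re_add_im _).symm
    rw [hFm, hw2, map_ofReal_mulVec] at hw
    rw [hFm]
    conv_lhs => rw [hw2, map_ofReal_mulVec]
    have h1 : ∀ i, Z.mulVec (fun i => (w i).re) i = 0 ∧ Z.mulVec (fun i => (w i).im) i = 0 := by
      intro i
      have := congrFun hw i
      rw [Complex.ext_iff] at this
      simpa using this
    rw [hQ _ (funext fun i => (h1 i).1), hQ _ (funext fun i => (h1 i).2)]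
    exact hw2.symm
  have hlim : Filter.Tendsto (fun k : ℕ => (F S) ^ k) Filter.atTop (nhds 0) := by
    refine tendsto_pow_zero_of_eigenvalues fun μ w hw hSw => ?_
    by_cases hμ : μ = 0
    · simp [hμ]
    -- the eigenspace lies in the kernel of `Q`
    have hker : ∀ w : ι → ℂ, (F S).mulVec w = μ • w → (F Q).mulVec w = 0 := by
      intro w hSw
      have h1 : F Q * F S = 0 := by
        rw [← map_mul, hS, ← mul_assoc, ← hTQ.eq, mul_assoc, mul_sub, mul_one, hQQ, sub_self,
          mul_zero, map_zero]
      have h2 : (F Q).mulVec ((F S).mulVec w) = 0 := by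
        rw [Matrix.mulVec_mulVec, h1, Matrix.zero_mulVec]
      rw [hSw, Matrix.mulVec_smul] at h2
      exact (smul_eq_zero.1 h2).resolve_left hμ
    have hST : ∀ w : ι → ℂ, (F Q).mulVec w = 0 → (F S).mulVec w = (F T).mulVec w := by
      intro w hw
      rw [hS, map_mul, map_sub, map_one, ← Matrix.mulVec_mulVec, Matrix.sub_mulVec, hw,
        Matrix.one_mulVec, sub_zero]
    have hSZ : Commute S Z := by
      rw [hS]
      refine hTZ.mul_left (Commute.sub_left (Commute.one_left _) ?_)
      rw [commute_iff_eq, hQZ, hZQ]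
    set V := Module.End.eigenspace (Matrix.toLin' (F S)) μ with hV
    have hmemV : ∀ w, w ∈ V ↔ (F S).mulVec w = μ • w := fun w => by
      rw [hV, Module.End.mem_eigenspace_iff, Matrix.toLin'_apply]
    have hmaps : ∀ w ∈ V, Matrix.toLin' (F Z) w ∈ V := by
      intro w hw
      rw [hmemV] at hw ⊢
      rw [Matrix.toLin'_apply, Matrix.mulVec_mulVec, ← map_mul, hSZ.eq, map_mul,
        ← Matrix.mulVec_mulVec, hw, Matrix.mulVec_smul]
    have : Nontrivial V := ⟨⟨⟨w, (hmemV w).2 hSw⟩, 0, fun h => hw (congrArg Subtype.val h)⟩⟩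
    -- The eigenspace `V` of `S` is invariant under `Z`, so it contains a common eigenvector `w'`.
    -- It lies in `ker Q`, which meets `ker Z` only in `0`; so `lam ≠ 0` and the hypothesis on `T`
    -- applies to `w'`.
    obtain ⟨lam, hlam⟩ := Module.End.exists_eigenvalue ((Matrix.toLin' (F Z)).restrict hmaps)
    obtain ⟨⟨w', hw'V⟩, hw'⟩ := hlam.exists_hasEigenvector
    have hw'0 : w' ≠ 0 := fun h => hw'.2 (Subtype.ext h)
    have hZw : (F Z).mulVec w' = lam • w' := by
      have := congrArg Subtype.val hw'.apply_eq_smul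
      simpa using this
    rw [hmemV] at hw'V
    have hQw := hker w' hw'V
    have hlam0 : lam ≠ 0 := by
      rintro rfl
      rw [zero_smul] at hZw
      exact hw'0 ((hkerC w' hZw).symm.trans hQw)
    obtain ⟨τ, hτ, hTw⟩ := hT lam w' hw'0 (hZ.re_eigenvalue_neg hw'0 hZw hlam0) hZw
    rw [hST w' hQw] at hw'V
    have h3 : τ • w' = μ • w' := by rw [← hTw, ← hw'V, hFm]
    rwa [← smul_left_injective ℂ hw'0 h3]
  have hlimR : Filter.Tendsto (fun k : ℕ => S ^ k) Filter.atTop (nhds 0) := by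
    refine tendsto_pi_nhds.2 fun i => tendsto_pi_nhds.2 fun j => ?_
    have h1 := (tendsto_pi_nhds.1 (tendsto_pi_nhds.1 hlim i) j)
    have h2 := (Complex.continuous_re.tendsto _).comp h1
    have h3 : ∀ k : ℕ, (((F S) ^ k) i j).re = (S ^ k) i j := fun k => by
      rw [← map_pow, hFm, Matrix.map_apply, Complex.ofReal_re]
    exact h2.congr h3
  obtain ⟨k, hk⟩ := ((tendsto_norm_zero.comp hlimR).eventually
    (gt_mem_nhds (show (0 : ℝ) < 1 / 2 by norm_num))).exists
  refine ⟨k, fun v hv => ?_⟩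
  have hpow : ∀ k : ℕ, (T ^ k).mulVec v = (S ^ k).mulVec v ∧ Q.mulVec ((T ^ k).mulVec v) = 0 := by
    intro k
    have hq : ∀ k : ℕ, Q.mulVec ((T ^ k).mulVec v) = 0 := fun k => by
      rw [Matrix.mulVec_mulVec, ← (hTQ.pow_left k).eq, ← Matrix.mulVec_mulVec, hv,
        Matrix.mulVec_zero]
    refine ⟨?_, hq k⟩
    induction k with
    | zero => simp
    | succ k ih =>
      rw [pow_succ' S, ← Matrix.mulVec_mulVec, ← ih, hS, ← Matrix.mulVec_mulVec,
        Matrix.sub_mulVec, hq k, Matrix.one_mulVec, sub_zero, Matrix.mulVec_mulVec, ← pow_succ']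
  rw [(hpow k).1]
  refine (Matrix.linfty_opNorm_mulVec _ _).trans ?_
  exact mul_le_mul_of_nonneg_right hk.le (norm_nonneg v)

end spectral

end Matrix


/-! ### The stability function as a quotient of quartics -/

namespace SSPMPRK3Coeffs

variable (P : SSPMPRK3Coeffs)

/-- Total weight of the Patankar term of the second stage. -/
def w2 : ℝ := P.β20 + P.β21

/-- Total weight of the Patankar term of the auxiliary stage `a`. -/
def w3 : ℝ := P.η3 + P.η4

/-- Total weight of the Patankar term of the last stage. -/
def w4 : ℝ := P.β30 + P.β31 + P.β32

/-- Quadratic coefficient of the numerator of the stability function of the second stage. -/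
def stage2Num2 : ℝ := -(P.β10 * P.β20 + P.n2 * (P.β10 * P.w2))

/-- Quadratic coefficient of the numerator of the stability function of `a`. -/
def auxNum2 : ℝ := (P.η1 + P.η2) * P.β10 * (P.w3 * (1 - P.s) - P.η3)

/-- Coefficients of the numerator of `1 + y⁽²⁾ - ρ`. -/
def corrNum1 : ℝ := -(P.β10 * (1 + P.α20 + P.n2))

/-- See `corrNum1`. -/
def corrNum2 : ℝ := P.β10 * P.w2 + P.stage2Num2 + P.n2 * (P.β10 * P.w2)

/-- Coefficients of the numerator of the stability function of `σ`. -/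
def sigmaNum2 : ℝ :=
  P.auxNum2 + P.η1 * (P.β10 * P.w2) + P.ζ * (P.corrNum2 - P.corrNum1 * P.w3)

/-- See `sigmaNum2`. -/
def sigmaNum3 : ℝ := -(P.auxNum2 * P.w2) - P.ζ * (P.corrNum2 * P.w3)

/-- Coefficients of the denominator
`(1 - β10 z) (1 - w2 z) (1 - w3 z) (1 - w4 z)` of the stability function. -/
def den1 : ℝ := -(P.β10 + P.w2 + P.w3 + P.w4)

/-- See `den1`. -/
def den2 : ℝ :=
  P.β10 * P.w2 + (P.β10 + P.w2) * P.w3 + P.w4 * (P.β10 + P.w2 + P.w3)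

/-- See `den1`. -/
def den3 : ℝ :=
  -(P.β10 * P.w2 * P.w3 + P.w4 * (P.β10 * P.w2 + (P.β10 + P.w2) * P.w3))

/-- See `den1`. -/
def den4 : ℝ := P.w4 * (P.β10 * P.w2 * P.w3)

/-- Coefficients of degrees three and four of the numerator of the stability function. -/
def num3 : ℝ :=
  -(P.α30 * (P.β10 * P.w2 * P.w3)) - P.α32 * (P.stage2Num2 * P.w3) +
    P.β30 * (P.β10 * P.w2 + (P.β10 + P.w2) * P.w3) + P.β31 * (P.w2 * P.w3) +
    P.β32 * (P.stage2Num2 + P.β10 * P.α20 * P.w3) - P.w4 * P.sigmaNum2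

/-- See `num3`. -/
def num4 : ℝ :=
  -(P.β30 * (P.β10 * P.w2 * P.w3)) - P.β32 * (P.stage2Num2 * P.w3) - P.w4 * P.sigmaNum3

end SSPMPRK3Coeffs

/-- Elimination of the stages from the scalar linearized scheme. -/
theorem stabilityFunction_eq {K : Type*} [Field K] [CharZero K]
    {α20 α21 α30 α31 α32 b β20 β21 β30 β31 β32 n1 n2 ζ η1 η2 η3 η4 s : K}
    (hn : n1 + n2 = 1) (hα2 : α20 + α21 = 1)
    {z Y1 ρ Y2 a σ T : K}
    (h1 : Y1 = 1 + b * (z * Y1))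
    (hρ : ρ = (n1 + 2 * n2) * Y1 - n2)
    (h2 : Y2 = α20 + α21 * Y1 + z * (β20 + β21 * Y1 + (β20 + β21) * (Y2 - ρ)))
    (h3 : a = η1 + η2 * Y1 + z * ((η1 + η2) * (η3 + η4 * Y1) +
      (η3 + η4) * (a - (η1 + η2) * ((1 - s) + s * Y1))))
    (hσ : σ = a + ζ * (1 + Y2 - ρ))
    (h4 : T = α30 + α31 * Y1 + α32 * Y2 + z * (β30 + β31 * Y1 + β32 * Y2 +
      (β30 + β31 + β32) * (T - σ))) :
    (1 - b * z) * (1 - (β20 + β21) * z) * (1 - (η3 + η4) * z) * (1 - (β30 + β31 + β32) * z) * T =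
      (α30 + β30 * z) * ((1 - b * z) * (1 - (β20 + β21) * z) * (1 - (η3 + η4) * z)) +
      (α31 + β31 * z) * ((1 - (β20 + β21) * z) * (1 - (η3 + η4) * z)) +
      (α32 + β32 * z) * (1 - (η3 + η4) * z) *
        (1 - b * α20 * z - (b * β20 + n2 * (b * (β20 + β21))) * z ^ 2) -
      (β30 + β31 + β32) * z * ((1 - (β20 + β21) * z) *
        (η1 + η2 - η1 * b * z + (η1 + η2) * b * ((η3 + η4) * (1 - s) - η3) * z ^ 2) +
        ζ * (1 - (η3 + η4) * z) *
          (1 - b * (1 + α20 + n2) * z + (b * (β20 + β21) -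
            (b * β20 + n2 * (b * (β20 + β21))) + n2 * (b * (β20 + β21))) * z ^ 2)) := by
  obtain rfl : n1 = 1 - n2 := by linear_combination hn
  obtain rfl : α21 = 1 - α20 := by linear_combination hα2
  -- Each quantity is cleared of its own denominators only: `a` does not involve `Y2`, so the factor
  -- of the second stage first meets that of the auxiliary stage in `σ`.
  have e1 : (1 - b * z) * Y1 = 1 := by linear_combination h1
  have eρ : (1 - b * z) * ρ = 1 + n2 * b * z := by
    linear_combination (1 - b * z) * hρ + (1 + n2) * e1
  have e2 : (1 - b * z) * (1 - (β20 + β21) * z) * Y2 =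
      1 - b * α20 * z - (b * β20 + n2 * (b * (β20 + β21))) * z ^ 2 := by
    linear_combination (1 - b * z) * h2 + (1 - α20 + z * β21) * e1 - z * (β20 + β21) * eρ
  have e3 : (1 - b * z) * (1 - (η3 + η4) * z) * a =
      η1 + η2 - η1 * b * z + (η1 + η2) * b * ((η3 + η4) * (1 - s) - η3) * z ^ 2 := by
    linear_combination (1 - b * z) * h3 +
      (η2 + z * ((η1 + η2) * η4 - (η3 + η4) * (η1 + η2) * s)) * e1
  have eσ : (1 - b * z) * (1 - (β20 + β21) * z) * (1 - (η3 + η4) * z) * σ =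
      (1 - (β20 + β21) * z) *
        (η1 + η2 - η1 * b * z + (η1 + η2) * b * ((η3 + η4) * (1 - s) - η3) * z ^ 2) +
        ζ * (1 - (η3 + η4) * z) *
          (1 - b * (1 + α20 + n2) * z + (b * (β20 + β21) -
            (b * β20 + n2 * (b * (β20 + β21))) + n2 * (b * (β20 + β21))) * z ^ 2) := by
    linear_combination (1 - b * z) * (1 - (β20 + β21) * z) * (1 - (η3 + η4) * z) * hσ +
      (1 - (β20 + β21) * z) * e3 + ζ * (1 - (η3 + η4) * z) * e2 -
      ζ * (1 - (η3 + η4) * z) * (1 - (β20 + β21) * z) * eρ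
  linear_combination (1 - b * z) * (1 - (β20 + β21) * z) * (1 - (η3 + η4) * z) * h4 +
    (α31 + β31 * z) * ((1 - (β20 + β21) * z) * (1 - (η3 + η4) * z)) * e1 +
    (α32 + β32 * z) * (1 - (η3 + η4) * z) * e2 - (β30 + β31 + β32) * z * eσ

namespace SSPMPRK3Coeffs.IsSSPMPRK3

variable {P : SSPMPRK3Coeffs} {η₂ : ℝ}

/-- The stability function as a quotient of polynomials of degree four, the order conditions
being used to express the low order coefficients of the numerator by those of the denominator. -/
theorem den_mul_eq_num (hP : P.IsSSPMPRK3 η₂) {z Y1 ρ Y2 a σ T : ℂ}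
    (h1 : Y1 = 1 + P.β10 * (z * Y1))
    (hρ : ρ = (P.n1 + 2 * P.n2) * Y1 - P.n2)
    (h2 : Y2 = P.α20 + P.α21 * Y1 + z * (P.β20 + P.β21 * Y1 + (P.β20 + P.β21) * (Y2 - ρ)))
    (h3 : a = P.η1 + P.η2 * Y1 + z * ((P.η1 + P.η2) * (P.η3 + P.η4 * Y1) +
      (P.η3 + P.η4) * (a - (P.η1 + P.η2) * ((1 - P.s) + P.s * Y1))))
    (hσ : σ = a + P.ζ * (1 + Y2 - ρ))
    (h4 : T = P.α30 + P.α31 * Y1 + P.α32 * Y2 + z * (P.β30 + P.β31 * Y1 + P.β32 * Y2 +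
      (P.β30 + P.β31 + P.β32) * (T - σ))) :
    (1 + P.den1 * z + P.den2 * z ^ 2 + P.den3 * z ^ 3 + P.den4 * z ^ 4) * T =
      1 + (P.den1 + 1 : ℝ) * z + (P.den2 + P.den1 + 1 / 2 : ℝ) * z ^ 2 + P.num3 * z ^ 3
        + P.num4 * z ^ 4 := by
  have hα2 := congrArg (Complex.ofReal) hP.α2_sum
  have hα3 := congrArg (Complex.ofReal) hP.α3_sum
  have hn := congrArg (Complex.ofReal) hP.n_sum
  have hη := congrArg (Complex.ofReal) hP.η_sum
  have o1 := congrArg (Complex.ofReal) hP.order_one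
  have o2 := congrArg (Complex.ofReal) hP.order_two
  have o3 := congrArg (Complex.ofReal) hP.order_two_weights
  have key := stabilityFunction_eq (b := (P.β10 : ℂ)) (by exact_mod_cast hP.n_sum)
    (by exact_mod_cast hP.α2_sum)
    h1 hρ h2 h3 hσ h4
  clear h1 hρ h2 h3 hσ h4
  simp only [b0, b1, b2, c2, dρ, dσ] at o1 o2 o3
  simp only [den1, den2, den3, den4, num3, num4, sigmaNum2, sigmaNum3, corrNum1, corrNum2,
    stage2Num2, auxNum2, w2, w3, w4]
  push_cast at *
  have hn1' : (P.n1 : ℂ) = 1 - P.n2 := by linear_combination hn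
  have hα20' : (P.α21 : ℂ) = 1 - P.α20 := by linear_combination hα2
  have hα30' : (P.α30 : ℂ) = 1 - P.α31 - P.α32 := by linear_combination hα3
  have hζ : (P.ζ : ℂ) = 1 - P.η1 - P.η2 := by linear_combination hη
  rw [hn1', hα20', hζ] at o3
  rw [hα20'] at o1 o2
  rw [hα30', hζ] at key ⊢
  -- `order_one` corrects the coefficient of `z`. In the coefficient of `z²` it enters again,
  -- multiplied by the linear coefficient of the first three denominator factors, next to the two
  -- second order conditions.
  linear_combination key + (z * o1 + z ^ 2 * ((-(P.β10 + (P.β20 + P.β21) + (P.η3 + P.η4))) * o1 +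
    o2 + o3))

end SSPMPRK3Coeffs.IsSSPMPRK3


/-! ### Interval enclosures of the coefficients -/

/-- Product rule of ball arithmetic. The centre `z₀` may be a rounding of `x₀ * y₀` with error `r`,
which keeps the decimals short. The centres may depend on parameters, with `K` and `M` bounding them
uniformly. -/
theorem near_mul {x y x₀ y₀ z₀ δ ε K M r η : ℝ} (hx : |x - x₀| ≤ δ) (hy : |y - y₀| ≤ ε)
    (hK : |x₀| ≤ K) (hM : |y₀| ≤ M) (hr : |x₀ * y₀ - z₀| ≤ r)
    (hη : δ * M + K * ε + δ * ε + r ≤ η) : |x * y - z₀| ≤ η := by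
  have hδ : 0 ≤ δ := (abs_nonneg _).trans hx
  have hK0 : 0 ≤ K := (abs_nonneg _).trans hK
  have e : x * y - z₀ = (x - x₀) * y₀ + x₀ * (y - y₀) + (x - x₀) * (y - y₀) + (x₀ * y₀ - z₀) := by
    ring
  have h1 : |(x - x₀) * y₀| ≤ δ * M := by rw [abs_mul]; gcongr
  have h2 : |x₀ * (y - y₀)| ≤ K * ε := by rw [abs_mul]; gcongr
  have h3 : |(x - x₀) * (y - y₀)| ≤ δ * ε := by rw [abs_mul]; gcongr
  rw [e]
  refine (abs_add_le _ _).trans ((add_le_add ((abs_add_le _ _).trans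
    (add_le_add (abs_add_le _ _) le_rfl)) le_rfl).trans ?_)
  linarith

namespace SSPMPRK3Coeffs.IsSSPMPRK3

variable {P : SSPMPRK3Coeffs}

set_option maxHeartbeats 1000000 in
/-- Enclosures of the coefficients of the stability function. -/
theorem enclosure {t u : ℝ} (hP : P.IsSSPMPRK3 t) (ht0 : 0 ≤ t) (ht1 : t ≤ 0.3712) (hu0 : 0 ≤ u)
    (hu1 : u ≤ 0.15) (hs : P.s = 5.6 + u) :
    |P.den1 - (-4.776873 + 1.283213 * t)| ≤ 0.00001 ∧
    |P.den2 - (6.727055 - 2.486089 * t)| ≤ 0.00001 ∧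
    |P.den3 - (-3.733226 + 1.573046 * t)| ≤ 0.00001 ∧
    |P.den4 - (0.716706 - 0.323893 * t)| ≤ 0.00001 ∧
    |P.num3 - (0.769048 + 0.397261 * u - 0.385854 * t - 0.17953 * (t * u))| ≤ 0.00003 ∧
    |P.num4 - (-0.604265 - 0.265974 * u + 0.36726 * t + 0.120199 * (t * u))| ≤ 0.00003 := by
  -- In every product below at most one centre depends on `t`, so all centres are combinations of
  -- `1`, `t`, `u`, `t * u`. A function of this form that is nonnegative on the rectangle is a
  -- nonnegative combination of these four corner products, so linear arithmetic suffices for the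
  -- bounds.
  have htu0 : 0 ≤ t * u := mul_nonneg ht0 hu0
  have htu1 : 0 ≤ t * (0.15 - u) := mul_nonneg ht0 (sub_nonneg.2 hu1)
  have htu2 : 0 ≤ (0.3712 - t) * u := mul_nonneg (sub_nonneg.2 ht1) hu0
  have htu3 : 0 ≤ (0.3712 - t) * (0.15 - u) := mul_nonneg (sub_nonneg.2 ht1) (sub_nonneg.2 hu1)
  have hB30 : |P.β30 - 0.200447| ≤ 0.00000048 := by
    obtain ⟨l, r⟩ := abs_le.1 hP.β30_near
    rw [abs_le]; constructor <;> linarith only [l, r]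
  have hB31 : |P.β31 - 0| ≤ 0.00000001 := by
    obtain ⟨l, r⟩ := abs_le.1 hP.β31_near
    rw [abs_le]; constructor <;> linarith only [l, r]
  have hB32 : |P.β32 - 0.591219| ≤ 0.00000019 := by
    obtain ⟨l, r⟩ := abs_le.1 hP.β32_near
    rw [abs_le]; constructor <;> linarith only [l, r]
  have hw4 : |P.w4 - 0.791666| ≤ 0.00000068 := by
    unfold w4
    obtain ⟨l0, r0⟩ := abs_le.1 hB30
    obtain ⟨l1, r1⟩ := abs_le.1 hB31
    obtain ⟨l2, r2⟩ := abs_le.1 hB32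
    rw [abs_le]; constructor <;> linarith only [l0, r0, l1, r1, l2, r2]
  have hb : |P.β10 - 0.476208| ≤ 0.0000002 := by
    obtain ⟨l, r⟩ := abs_le.1 hP.β10_near
    rw [abs_le]; constructor <;> linarith only [l, r]
  have hB20 : |P.β20 - 0.077545| ≤ 0.00000045 := by
    obtain ⟨l, r⟩ := abs_le.1 hP.β20_near
    rw [abs_le]; constructor <;> linarith only [l, r]
  have hB21 : |P.β21 - 0.591975| ≤ 0.00000001 := by
    obtain ⟨l, r⟩ := abs_le.1 hP.β21_near
    rw [abs_le]; constructor <;> linarith only [l, r]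
  have hw2 : |P.w2 - 0.66952| ≤ 0.00000046 := by
    unfold w2
    obtain ⟨l0, r0⟩ := abs_le.1 hB20
    obtain ⟨l1, r1⟩ := abs_le.1 hB21
    rw [abs_le]; constructor <;> linarith only [l0, r0, l1, r1]
  clear hB21
  have hbw2 : |P.β10 * P.w2 - 0.318831| ≤ 0.00000058 := by
    refine near_mul hb hw2 (K := 0.48) (M := 0.67) (r := 0.00000022) ?_ ?_ ?_ ?_
    · norm_num [abs_le]
    · norm_num [abs_le]
    · norm_num [abs_le]
    · norm_num
  have hH3 : |P.η3 - (0.614603 - 1.283213 * t)| ≤ 0.00000045 := by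
    obtain ⟨l, r⟩ := abs_le.1 hP.η3_near
    rw [abs_le]; constructor <;> linarith only [l, r, ht0, ht1]
  have hH4 : |P.η4 - 2.224876| ≤ 0.00000005 := by
    obtain ⟨l, r⟩ := abs_le.1 hP.η4_near
    rw [abs_le]; constructor <;> linarith only [l, r]
  have hw3 : |P.w3 - (2.839479 - 1.283213 * t)| ≤ 0.0000005 := by
    unfold w3
    obtain ⟨l0, r0⟩ := abs_le.1 hH3
    obtain ⟨l1, r1⟩ := abs_le.1 hH4
    rw [abs_le]; constructor <;> linarith only [l0, r0, l1, r1]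
  clear hH4
  have hbww : |P.β10 * P.w2 * P.w3 - (0.905314 - 0.409128 * t)| ≤ 0.00000192 := by
    refine near_mul hbw2 hw3 (K := 0.32) (M := 2.84) (r := 0.00000011) ?_ ?_ ?_ ?_
    · norm_num [abs_le]
    · rw [abs_le]; constructor <;> linarith only [ht0, ht1]
    · rw [abs_le]; constructor <;> linarith only [ht0, ht1]
    · norm_num
  have hd4 : |P.den4 - (0.716706 - 0.323893 * t)| ≤ 0.00000258 := by
    refine near_mul hw4 hbww (K := 0.8) (M := 0.91) (r := 0.00000042) ?_ ?_ ?_ ?_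
    · norm_num [abs_le]
    · rw [abs_le]; constructor <;> linarith only [ht0, ht1]
    · rw [abs_le]; constructor <;> linarith only [ht0, ht1]
    · norm_num
  have hm1 : |(P.β10 + P.w2 + P.w3) - (3.985207 - 1.283213 * t)| ≤ 0.00000116 := by
    obtain ⟨l0, r0⟩ := abs_le.1 hb
    obtain ⟨l1, r1⟩ := abs_le.1 hw2
    obtain ⟨l2, r2⟩ := abs_le.1 hw3
    rw [abs_le]; constructor <;> linarith only [l0, r0, l1, r1, l2, r2]
  have hd1 : |P.den1 - (-4.776873 + 1.283213 * t)| ≤ 0.00000184 := by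
    unfold den1
    obtain ⟨l0, r0⟩ := abs_le.1 hm1
    obtain ⟨l1, r1⟩ := abs_le.1 hw4
    rw [abs_le]; constructor <;> linarith only [l0, r0, l1, r1]
  have hbpw : |(P.β10 + P.w2) - 1.145728| ≤ 0.00000066 := by
    obtain ⟨l0, r0⟩ := abs_le.1 hb
    obtain ⟨l1, r1⟩ := abs_le.1 hw2
    rw [abs_le]; constructor <;> linarith only [l0, r0, l1, r1]
  have hbpww : |(P.β10 + P.w2) * P.w3 - (3.253271 - 1.470213 * t)| ≤ 0.00000288 := by
    refine near_mul hbpw hw3 (K := 1.15) (M := 2.84) (r := 0.00000043) ?_ ?_ ?_ ?_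
    · norm_num [abs_le]
    · rw [abs_le]; constructor <;> linarith only [ht0, ht1]
    · rw [abs_le]; constructor <;> linarith only [ht0, ht1]
    · norm_num
  clear hbpw
  have hm2 : |(P.β10 * P.w2 + (P.β10 + P.w2) * P.w3) - (3.572102 - 1.470213 * t)| ≤ 0.00000346 := by
    obtain ⟨l0, r0⟩ := abs_le.1 hbw2
    obtain ⟨l1, r1⟩ := abs_le.1 hbpww
    rw [abs_le]; constructor <;> linarith only [l0, r0, l1, r1]
  clear hbpww
  have hwm1 : |P.w4 * (P.β10 + P.w2 + P.w3) - (3.154953 - 1.015876 * t)| ≤ 0.00000381 := by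
    refine near_mul hw4 hm1 (K := 0.8) (M := 3.99) (r := 0.00000016) ?_ ?_ ?_ ?_
    · norm_num [abs_le]
    · rw [abs_le]; constructor <;> linarith only [ht0, ht1]
    · rw [abs_le]; constructor <;> linarith only [ht0, ht1]
    · norm_num
  clear hm1
  have hd2 : |P.den2 - (6.727055 - 2.486089 * t)| ≤ 0.00000727 := by
    unfold den2
    obtain ⟨l0, r0⟩ := abs_le.1 hm2
    obtain ⟨l1, r1⟩ := abs_le.1 hwm1
    rw [abs_le]; constructor <;> linarith only [l0, r0, l1, r1]
  clear hwm1
  have hwm2 : |P.w4 * (P.β10 * P.w2 + (P.β10 + P.w2) * P.w3) - (2.827912 - 1.163918 * t)| ≤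
      0.00000551 := by
    refine near_mul hw4 hm2 (K := 0.8) (M := 3.58) (r := 0.0000003) ?_ ?_ ?_ ?_
    · norm_num [abs_le]
    · rw [abs_le]; constructor <;> linarith only [ht0, ht1]
    · rw [abs_le]; constructor <;> linarith only [ht0, ht1]
    · norm_num
  have hd3 : |P.den3 - (-3.733226 + 1.573046 * t)| ≤ 0.00000743 := by
    unfold den3
    obtain ⟨l0, r0⟩ := abs_le.1 hbww
    obtain ⟨l1, r1⟩ := abs_le.1 hwm2
    rw [abs_le]; constructor <;> linarith only [l0, r0, l1, r1]
  clear hwm2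
  have hr7 : |P.β30 * (P.β10 * P.w2 * P.w3) - (0.181467 - 0.082008 * t)| ≤ 0.00000133 := by
    refine near_mul hB30 hbww (K := 0.21) (M := 0.91) (r := 0.00000048) ?_ ?_ ?_ ?_
    · norm_num [abs_le]
    · rw [abs_le]; constructor <;> linarith only [ht0, ht1]
    · rw [abs_le]; constructor <;> linarith only [ht0, ht1]
    · norm_num
  have hbB20 : |P.β10 * P.β20 - 0.036928| ≤ 0.0000007 := by
    refine near_mul hb hB20 (K := 0.48) (M := 0.08) (r := 0.00000046) ?_ ?_ ?_ ?_
    · norm_num [abs_le]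
    · norm_num [abs_le]
    · norm_num [abs_le]
    · norm_num
  clear hB20
  have hN2 : |P.n2 - 0.743095| ≤ 0.0000004 := by
    obtain ⟨l, r⟩ := abs_le.1 hP.n1_near
    have h := hP.n_sum
    rw [abs_le]; constructor <;> linarith only [l, r, h]
  have hnbw : |P.n2 * (P.β10 * P.w2) - 0.236922| ≤ 0.00000085 := by
    refine near_mul hN2 hbw2 (K := 0.75) (M := 0.32) (r := 0.00000028) ?_ ?_ ?_ ?_
    · norm_num [abs_le]
    · norm_num [abs_le]
    · norm_num [abs_le]
    · norm_num
  have hs2 : |P.stage2Num2 - (-0.27385)| ≤ 0.00000155 := by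
    unfold stage2Num2
    obtain ⟨l0, r0⟩ := abs_le.1 hbB20
    obtain ⟨l1, r1⟩ := abs_le.1 hnbw
    rw [abs_le]; constructor <;> linarith only [l0, r0, l1, r1]
  clear hbB20
  have hs2w : |P.stage2Num2 * P.w3 - (-0.777591 + 0.351408 * t)| ≤ 0.00000492 := by
    refine near_mul hs2 hw3 (K := 0.28) (M := 2.84) (r := 0.00000037) ?_ ?_ ?_ ?_
    · norm_num [abs_le]
    · rw [abs_le]; constructor <;> linarith only [ht0, ht1]
    · rw [abs_le]; constructor <;> linarith only [ht0, ht1]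
    · norm_num
  have hr8 : |P.β32 * (P.stage2Num2 * P.w3) - (-0.459727 + 0.207759 * t)| ≤ 0.00000357 := by
    refine near_mul hB32 hs2w (K := 0.6) (M := 0.78) (r := 0.00000046) ?_ ?_ ?_ ?_
    · norm_num [abs_le]
    · rw [abs_le]; constructor <;> linarith only [ht0, ht1]
    · rw [abs_le]; constructor <;> linarith only [ht0, ht1]
    · norm_num
  -- Since `η1 + η2 = 1 - ζ`, this centre is free of `t`.
  have he : |(P.η1 + P.η2) - 0.371106| ≤ 0.0000002 := by
    obtain ⟨l, r⟩ := abs_le.1 hP.ζ_near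
    have h := hP.η_sum
    rw [abs_le]; constructor <;> linarith only [l, r, h]
  have heb : |(P.η1 + P.η2) * P.β10 - 0.176724| ≤ 0.00000054 := by
    refine near_mul he hb (K := 0.38) (M := 0.48) (r := 0.00000036) ?_ ?_ ?_ ?_
    · norm_num [abs_le]
    · norm_num [abs_le]
    · norm_num [abs_le]
    · norm_num
  clear he
  have hS : |(1 - P.s) - (-4.6 - 1 * u)| ≤ 0 := by
    rw [abs_le]; constructor <;> linarith only [hs]
  have hwS : |P.w3 * (1 - P.s) - (-13.061603 - 2.839479 * u + 5.90278 * t + 1.283213 * (t * u))| ≤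
      0.00000286 := by
    refine near_mul hw3 hS (K := 2.84) (M := 4.75) (r := 0.00000048) ?_ ?_ ?_ ?_
    · rw [abs_le]; constructor <;> linarith only [ht0, ht1]
    · rw [abs_le]; constructor <;> linarith only [hu0, hu1]
    · rw [abs_le]; constructor <;> linarith only [ht0, ht1, hu0, hu1, htu0, htu1, htu2, htu3]
    · norm_num
  clear hS
  have hx : |(P.w3 * (1 - P.s) - P.η3) - (-13.676206 - 2.839479 * u + 7.185993 * t + 1.283213 * (t
      * u))| ≤ 0.00000331 := by
    obtain ⟨l0, r0⟩ := abs_le.1 hwS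
    obtain ⟨l1, r1⟩ := abs_le.1 hH3
    rw [abs_le]; constructor <;> linarith only [l0, r0, l1, r1]
  clear hH3 hwS
  have hm : |P.auxNum2 - (-2.416914 - 0.501804 * u + 1.269937 * t + 0.226775 * (t * u))| ≤
      0.00000855 := by
    refine near_mul heb hx (K := 0.18) (M := 14.11) (r := 0.00000033) ?_ ?_ ?_ ?_
    · norm_num [abs_le]
    · rw [abs_le]; constructor <;> linarith only [ht0, ht1, hu0, hu1, htu0, htu1, htu2, htu3]
    · rw [abs_le]; constructor <;> linarith only [ht0, ht1, hu0, hu1, htu0, htu1, htu2, htu3]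
    · norm_num
  clear heb hx
  have hmw : |P.auxNum2 * P.w2 - (-1.618172 - 0.335968 * u + 0.850248 * t + 0.15183 * (t * u))| ≤
      0.00000715 := by
    refine near_mul hm hw2 (K := 2.5) (M := 0.67) (r := 0.00000027) ?_ ?_ ?_ ?_
    · rw [abs_le]; constructor <;> linarith only [ht0, ht1, hu0, hu1, htu0, htu1, htu2, htu3]
    · norm_num [abs_le]
    · rw [abs_le]; constructor <;> linarith only [ht0, ht1, hu0, hu1, htu0, htu1, htu2, htu3]
    · norm_num
  have hZ : |P.ζ - 0.628894| ≤ 0.0000002 := by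
    obtain ⟨l, r⟩ := abs_le.1 hP.ζ_near
    rw [abs_le]; constructor <;> linarith only [l, r]
  have hk2 : |P.corrNum2 - 0.281903| ≤ 0.00000298 := by
    unfold corrNum2
    obtain ⟨l0, r0⟩ := abs_le.1 hbw2
    obtain ⟨l1, r1⟩ := abs_le.1 hs2
    obtain ⟨l2, r2⟩ := abs_le.1 hnbw
    rw [abs_le]; constructor <;> linarith only [l0, r0, l1, r1, l2, r2]
  clear hnbw
  have hk2w : |P.corrNum2 * P.w3 - (0.800458 - 0.361742 * t)| ≤ 0.00000897 := by
    refine near_mul hk2 hw3 (K := 0.29) (M := 2.84) (r := 0.00000036) ?_ ?_ ?_ ?_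
    · norm_num [abs_le]
    · rw [abs_le]; constructor <;> linarith only [ht0, ht1]
    · rw [abs_le]; constructor <;> linarith only [ht0, ht1]
    · norm_num
  have hzk3 : |P.ζ * (P.corrNum2 * P.w3) - (0.503403 - 0.227497 * t)| ≤ 0.00000606 := by
    refine near_mul hZ hk2w (K := 0.63) (M := 0.81) (r := 0.00000024) ?_ ?_ ?_ ?_
    · norm_num [abs_le]
    · rw [abs_le]; constructor <;> linarith only [ht0, ht1]
    · rw [abs_le]; constructor <;> linarith only [ht0, ht1]
    · norm_num
  clear hk2w
  have hg3 : |P.sigmaNum3 - (1.114769 + 0.335968 * u - 0.622751 * t - 0.15183 * (t * u))| ≤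
      0.00001321 := by
    unfold sigmaNum3
    obtain ⟨l0, r0⟩ := abs_le.1 hmw
    obtain ⟨l1, r1⟩ := abs_le.1 hzk3
    rw [abs_le]; constructor <;> linarith only [l0, r0, l1, r1]
  clear hmw hzk3
  have hwg3 : |P.w4 * P.sigmaNum3 - (0.882525 + 0.265974 * u - 0.493011 * t - 0.120199 * (t * u))|
      ≤ 0.00001166 := by
    refine near_mul hw4 hg3 (K := 0.8) (M := 1.17) (r := 0.00000029) ?_ ?_ ?_ ?_
    · norm_num [abs_le]
    · rw [abs_le]; constructor <;> linarith only [ht0, ht1, hu0, hu1, htu0, htu1, htu2, htu3]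
    · rw [abs_le]; constructor <;> linarith only [ht0, ht1, hu0, hu1, htu0, htu1, htu2, htu3]
    · norm_num
  clear hg3
  have hp4 : |P.num4 - (-0.604265 - 0.265974 * u + 0.36726 * t + 0.120199 * (t * u))| ≤
      0.00001656 := by
    unfold num4
    obtain ⟨l0, r0⟩ := abs_le.1 hr7
    obtain ⟨l1, r1⟩ := abs_le.1 hr8
    obtain ⟨l2, r2⟩ := abs_le.1 hwg3
    rw [abs_le]; constructor <;> linarith only [l0, r0, l1, r1, l2, r2]
  clear hr7 hr8 hwg3
  have hA30 : |P.α30 - 0.70439| ≤ 0.00000041 := by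
    obtain ⟨l, r⟩ := abs_le.1 hP.α30_near
    rw [abs_le]; constructor <;> linarith only [l, r]
  have hr1 : |P.α30 * (P.β10 * P.w2 * P.w3) - (0.637694 - 0.288186 * t)| ≤ 0.000002 := by
    refine near_mul hA30 hbww (K := 0.71) (M := 0.91) (r := 0.00000026) ?_ ?_ ?_ ?_
    · norm_num [abs_le]
    · rw [abs_le]; constructor <;> linarith only [ht0, ht1]
    · rw [abs_le]; constructor <;> linarith only [ht0, ht1]
    · norm_num
  clear hbww hA30
  have hA32 : |P.α32 - 0.29561| ≤ 0.00000041 := by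
    obtain ⟨l, r⟩ := abs_le.1 hP.α32_near
    rw [abs_le]; constructor <;> linarith only [l, r]
  have hr2 : |P.α32 * (P.stage2Num2 * P.w3) - (-0.229864 + 0.10388 * t)| ≤ 0.00000213 := by
    refine near_mul hA32 hs2w (K := 0.3) (M := 0.78) (r := 0.00000033) ?_ ?_ ?_ ?_
    · norm_num [abs_le]
    · rw [abs_le]; constructor <;> linarith only [ht0, ht1]
    · rw [abs_le]; constructor <;> linarith only [ht0, ht1]
    · norm_num
  clear hs2w hA32
  have hr3 : |P.β30 * (P.β10 * P.w2 + (P.β10 + P.w2) * P.w3) - (0.716017 - 0.2947 * t)| ≤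
      0.00000266 := by
    refine near_mul hB30 hm2 (K := 0.21) (M := 3.58) (r := 0.00000021) ?_ ?_ ?_ ?_
    · norm_num [abs_le]
    · rw [abs_le]; constructor <;> linarith only [ht0, ht1]
    · rw [abs_le]; constructor <;> linarith only [ht0, ht1]
    · norm_num
  clear hB30 hm2
  have hww : |P.w2 * P.w3 - (1.901088 - 0.859137 * t)| ≤ 0.00000172 := by
    refine near_mul hw2 hw3 (K := 0.67) (M := 2.84) (r := 0.00000007) ?_ ?_ ?_ ?_
    · norm_num [abs_le]
    · rw [abs_le]; constructor <;> linarith only [ht0, ht1]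
    · rw [abs_le]; constructor <;> linarith only [ht0, ht1]
    · norm_num
  clear hw2
  have hr4 : |P.β31 * (P.w2 * P.w3) - 0| ≤ 0.00000002 := by
    refine near_mul hB31 hww (K := 0) (M := 1.91) (r := 0) ?_ ?_ ?_ ?_
    · norm_num [abs_le]
    · rw [abs_le]; constructor <;> linarith only [ht0, ht1]
    · rw [abs_le]; constructor <;> linarith only []
    · norm_num
  clear hB31 hww
  have hA20 : |P.α20 - 0.926003| ≤ 0.00000013 := by
    obtain ⟨l, r⟩ := abs_le.1 hP.α20_near
    rw [abs_le]; constructor <;> linarith only [l, r]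
  have hbA : |P.β10 * P.α20 - 0.44097| ≤ 0.00000029 := by
    refine near_mul hb hA20 (K := 0.48) (M := 0.93) (r := 0.00000004) ?_ ?_ ?_ ?_
    · norm_num [abs_le]
    · norm_num [abs_le]
    · norm_num [abs_le]
    · norm_num
  have hbAw : |P.β10 * P.α20 * P.w3 - (1.252125 - 0.565858 * t)| ≤ 0.00000116 := by
    refine near_mul hbA hw3 (K := 0.45) (M := 2.84) (r := 0.00000011) ?_ ?_ ?_ ?_
    · norm_num [abs_le]
    · rw [abs_le]; constructor <;> linarith only [ht0, ht1]
    · rw [abs_le]; constructor <;> linarith only [ht0, ht1]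
    · norm_num
  clear hbA
  have hr5 : |(P.stage2Num2 + P.β10 * P.α20 * P.w3) - (0.978275 - 0.565858 * t)| ≤ 0.00000271 := by
    obtain ⟨l0, r0⟩ := abs_le.1 hs2
    obtain ⟨l1, r1⟩ := abs_le.1 hbAw
    rw [abs_le]; constructor <;> linarith only [l0, r0, l1, r1]
  clear hs2 hbAw
  have hr6 : |P.β32 * (P.stage2Num2 + P.β10 * P.α20 * P.w3) - (0.578375 - 0.334546 * t)| ≤
      0.00000206 := by
    refine near_mul hB32 hr5 (K := 0.6) (M := 0.98) (r := 0.00000024) ?_ ?_ ?_ ?_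
    · norm_num [abs_le]
    · rw [abs_le]; constructor <;> linarith only [ht0, ht1]
    · rw [abs_le]; constructor <;> linarith only [ht0, ht1]
    · norm_num
  clear hB32 hr5
  have hH1 : |P.η1 - (0.371106 - 1 * t)| ≤ 0.0000002 := by
    obtain ⟨l, r⟩ := abs_le.1 hP.η1_near
    rw [abs_le]; constructor <;> linarith only [l, r, ht0, ht1]
  have hh1b : |P.η1 * (P.β10 * P.w2) - (0.11832 - 0.318831 * t)| ≤ 0.00000039 := by
    refine near_mul hH1 hbw2 (K := 0.38) (M := 0.32) (r := 0.0000001) ?_ ?_ ?_ ?_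
    · rw [abs_le]; constructor <;> linarith only [ht0, ht1]
    · norm_num [abs_le]
    · rw [abs_le]; constructor <;> linarith only [ht0, ht1]
    · norm_num
  clear hbw2 hH1
  have hy : |(1 + P.α20 + P.n2) - 2.669098| ≤ 0.00000053 := by
    obtain ⟨l1, r1⟩ := abs_le.1 hA20
    obtain ⟨l2, r2⟩ := abs_le.1 hN2
    rw [abs_le]; constructor <;> linarith only [l1, r1, l2, r2]
  clear hN2 hA20
  have hby : |P.β10 * (1 + P.α20 + P.n2) - 1.271046| ≤ 0.00000097 := by
    refine near_mul hb hy (K := 0.48) (M := 2.67) (r := 0.00000018) ?_ ?_ ?_ ?_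
    · norm_num [abs_le]
    · norm_num [abs_le]
    · norm_num [abs_le]
    · norm_num
  clear hb hy
  have hk1 : |P.corrNum1 - (-1.271046)| ≤ 0.00000097 := by
    unfold corrNum1
    obtain ⟨l0, r0⟩ := abs_le.1 hby
    rw [abs_le]; constructor <;> linarith only [l0, r0]
  clear hby
  have hk1w : |P.corrNum1 * P.w3 - (-3.609108 + 1.631023 * t)| ≤ 0.00000392 := by
    refine near_mul hk1 hw3 (K := 1.28) (M := 2.84) (r := 0.00000052) ?_ ?_ ?_ ?_
    · norm_num [abs_le]
    · rw [abs_le]; constructor <;> linarith only [ht0, ht1]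
    · rw [abs_le]; constructor <;> linarith only [ht0, ht1]
    · norm_num
  clear hw3 hk1
  have hkk : |(P.corrNum2 - P.corrNum1 * P.w3) - (3.891011 - 1.631023 * t)| ≤ 0.0000069 := by
    obtain ⟨l0, r0⟩ := abs_le.1 hk2
    obtain ⟨l1, r1⟩ := abs_le.1 hk1w
    rw [abs_le]; constructor <;> linarith only [l0, r0, l1, r1]
  clear hk2 hk1w
  have hzk : |P.ζ * (P.corrNum2 - P.corrNum1 * P.w3) - (2.447033 - 1.025741 * t)| ≤ 0.00000576 := by
    refine near_mul hZ hkk (K := 0.63) (M := 3.9) (r := 0.00000063) ?_ ?_ ?_ ?_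
    · norm_num [abs_le]
    · rw [abs_le]; constructor <;> linarith only [ht0, ht1]
    · rw [abs_le]; constructor <;> linarith only [ht0, ht1]
    · norm_num
  clear hZ hkk
  have hg2 : |P.sigmaNum2 - (0.148439 - 0.501804 * u - 0.074635 * t + 0.226775 * (t * u))| ≤
      0.0000147 := by
    unfold sigmaNum2
    obtain ⟨l0, r0⟩ := abs_le.1 hm
    obtain ⟨l1, r1⟩ := abs_le.1 hh1b
    obtain ⟨l2, r2⟩ := abs_le.1 hzk
    rw [abs_le]; constructor <;> linarith only [l0, r0, l1, r1, l2, r2]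
  clear hm hh1b hzk
  have hwg2 : |P.w4 * P.sigmaNum2 - (0.117514 - 0.397261 * u - 0.059086 * t + 0.17953 * (t * u))| ≤
      0.00001199 := by
    refine near_mul hw4 hg2 (K := 0.8) (M := 0.15) (r := 0.00000012) ?_ ?_ ?_ ?_
    · norm_num [abs_le]
    · rw [abs_le]; constructor <;> linarith only [ht0, ht1, hu0, hu1, htu0, htu1, htu2, htu3]
    · rw [abs_le]; constructor <;> linarith only [ht0, ht1, hu0, hu1, htu0, htu1, htu2, htu3]
    · norm_num
  clear hw4 hg2
  have hp3 : |P.num3 - (0.769048 + 0.397261 * u - 0.385854 * t - 0.17953 * (t * u))| ≤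
      0.00002086 := by
    unfold num3
    obtain ⟨l0, r0⟩ := abs_le.1 hr1
    obtain ⟨l1, r1⟩ := abs_le.1 hr2
    obtain ⟨l2, r2⟩ := abs_le.1 hr3
    obtain ⟨l3, r3⟩ := abs_le.1 hr4
    obtain ⟨l4, r4⟩ := abs_le.1 hr6
    obtain ⟨l5, r5⟩ := abs_le.1 hwg2
    rw [abs_le]; constructor <;> linarith only [l0, r0, l1, r1, l2, r2, l3, r3, l4, r4, l5, r5]
  clear hr1 hr2 hr3 hr4 hr6 hwg2
  refine ⟨hd1.trans ?_, hd2.trans ?_, hd3.trans ?_, hd4.trans ?_, hp3.trans ?_, hp4.trans ?_⟩ <;>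
    norm_num

end SSPMPRK3Coeffs.IsSSPMPRK3


/-! ### The modulus bound in the left half-plane -/

/-- A polynomial of degree four with constant term one dominates another one in the open left
half-plane if the coefficients of `|D (-x + i y)| ^ 2 - |N (-x + i y)| ^ 2` are nonnegative. -/
theorem norm_quartic_lt_of_re_neg {q1 q2 q3 q4 p3 p4 : ℝ}
    (c0 : 0 ≤ -1 / 4 + 2 * p3 - 2 * p4 - q1 - q2 + 2 * q4 + 2 * p3 * q1 - q1 ^ 2 - 2 * q1 * q2 - 2
        * q1 * q3)
    (c1 : 0 ≤ p4 - p3 ^ 2 + 2 * p4 * q1 + 2 * p4 * q2 - 2 * q2 * q4 + q3 ^ 2)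
    (c2 : 0 ≤ -p4 ^ 2 + q4 ^ 2)
    (c4 : 0 ≤ 1 - 6 * p3 + 3 * q1 + 2 * q2 + 6 * q3 + 2 * q1 ^ 2)
    (c5 : 0 ≤ p3 - 6 * p4 + 2 * p3 * q1 + 2 * p3 * q2 - 6 * p4 * q1 + 6 * q1 * q4 - 2 * q2 * q3)
    (c6 : 0 ≤ 2 * p3 * p4 - 2 * q3 * q4)
    (c7 : 0 ≤ -2 - 4 * q1)
    (c8 : 0 ≤ -1 / 2 + 12 * p4 - 2 * q1 - 2 * q2 - 12 * q4 - 2 * q1 ^ 2 - 4 * q1 * q2)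
    (c9 : 0 ≤ p4 - 3 * p3 ^ 2 + 2 * p4 * q1 + 2 * p4 * q2 - 2 * q2 * q4 + 3 * q3 ^ 2)
    (c10 : 0 ≤ 1 + 2 * p3 + 3 * q1 + 2 * q2 - 2 * q3 + 2 * q1 ^ 2)
    (c11 : 0 ≤ 2 * p3 - 4 * p4 + 4 * p3 * q1 + 4 * p3 * q2 - 4 * p4 * q1 + 4 * q1 * q4 - 4 * q2 *
        q3)
    (c12 : 0 ≤ -1 / 4 - 2 * p3 - 2 * p4 - q1 - q2 + 2 * q4 - 2 * p3 * q1 - q1 ^ 2 - 2 * q1 * q2 + 2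
        * q1 * q3)
    (c13 : 0 ≤ -p4 - 3 * p3 ^ 2 - 2 * p4 * q1 - 2 * p4 * q2 + 2 * q2 * q4 + 3 * q3 ^ 2)
    (c14 : 0 ≤ p3 + 2 * p4 + 2 * p3 * q1 + 2 * p3 * q2 + 2 * p4 * q1 - 2 * q1 * q4 - 2 * q2 * q3)
    (c15 : 0 ≤ -p4 - p3 ^ 2 - 2 * p4 * q1 - 2 * p4 * q2 + 2 * q2 * q4 + q3 ^ 2)
    {z : ℂ} (hz : z.re < 0) :
    ‖1 + (q1 + 1 : ℝ) * z + (q2 + q1 + 1 / 2 : ℝ) * z ^ 2 + p3 * z ^ 3 + p4 * z ^ 4‖ <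
      ‖1 + q1 * z + q2 * z ^ 2 + q3 * z ^ 3 + q4 * z ^ 4‖ := by
  obtain ⟨x, hx⟩ : ∃ x, z.re = -x := ⟨-z.re, (neg_neg _).symm⟩
  obtain ⟨y, hy⟩ : ∃ y, z.im = y := ⟨_, rfl⟩
  have hx0 : 0 < x := by linarith
  have hy2 : 0 ≤ y ^ 2 := sq_nonneg y
  have hzz : z = ⟨-x, y⟩ := Complex.ext hx hy
  refine lt_of_pow_lt_pow_left₀ 2 (norm_nonneg _) ?_
  rw [← Complex.normSq_eq_norm_sq, ← Complex.normSq_eq_norm_sq, ← sub_pos]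
  -- Because the two polynomials differ by the factor `e^z` up to `z²`, the part free of `x` starts
  -- at `y⁴` and the coefficient of `x` is exactly `2`. The coefficients of degrees eight and seven
  -- recur with binomial factors, as they come from `|z| ^ 8` and `x |z| ^ 6`.
  have key : Complex.normSq (1 + q1 * z + q2 * z ^ 2 + q3 * z ^ 3 + q4 * z ^ 4) -
      Complex.normSq (1 + (q1 + 1 : ℝ) * z + (q2 + q1 + 1 / 2 : ℝ) * z ^ 2 + p3 * z ^ 3 + p4 * z ^
          4) =
      (-1 / 4 + 2 * p3 - 2 * p4 - q1 - q2 + 2 * q4 + 2 * p3 * q1 - q1 ^ 2 - 2 * q1 * q2 - 2 * q1 *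
          q3) * ((y ^ 2) ^ 2) +
      (p4 - p3 ^ 2 + 2 * p4 * q1 + 2 * p4 * q2 - 2 * q2 * q4 + q3 ^ 2) * ((y ^ 2) ^ 3) +
      (-p4 ^ 2 + q4 ^ 2) * ((y ^ 2) ^ 4) +
      2 * (x) +
      (1 - 6 * p3 + 3 * q1 + 2 * q2 + 6 * q3 + 2 * q1 ^ 2) * (x * y ^ 2) +
      (p3 - 6 * p4 + 2 * p3 * q1 + 2 * p3 * q2 - 6 * p4 * q1 + 6 * q1 * q4 - 2 * q2 * q3) * (x * (y
          ^ 2) ^ 2) +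
      (2 * p3 * p4 - 2 * q3 * q4) * (x * (y ^ 2) ^ 3) +
      (-2 - 4 * q1) * (x ^ 2) +
      (-1 / 2 + 12 * p4 - 2 * q1 - 2 * q2 - 12 * q4 - 2 * q1 ^ 2 - 4 * q1 * q2) * (x ^ 2 * y ^ 2) +
      (p4 - 3 * p3 ^ 2 + 2 * p4 * q1 + 2 * p4 * q2 - 2 * q2 * q4 + 3 * q3 ^ 2) * (x ^ 2 * (y ^ 2) ^
          2) +
      4 * (-p4 ^ 2 + q4 ^ 2) * (x ^ 2 * (y ^ 2) ^ 3) +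
      (1 + 2 * p3 + 3 * q1 + 2 * q2 - 2 * q3 + 2 * q1 ^ 2) * (x ^ 3) +
      (2 * p3 - 4 * p4 + 4 * p3 * q1 + 4 * p3 * q2 - 4 * p4 * q1 + 4 * q1 * q4 - 4 * q2 * q3) * (x
          ^ 3 * y ^ 2) +
      3 * (2 * p3 * p4 - 2 * q3 * q4) * (x ^ 3 * (y ^ 2) ^ 2) +
      (-1 / 4 - 2 * p3 - 2 * p4 - q1 - q2 + 2 * q4 - 2 * p3 * q1 - q1 ^ 2 - 2 * q1 * q2 + 2 * q1 *
          q3) * (x ^ 4) +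
      (-p4 - 3 * p3 ^ 2 - 2 * p4 * q1 - 2 * p4 * q2 + 2 * q2 * q4 + 3 * q3 ^ 2) * (x ^ 4 * y ^ 2) +
      6 * (-p4 ^ 2 + q4 ^ 2) * (x ^ 4 * (y ^ 2) ^ 2) +
      (p3 + 2 * p4 + 2 * p3 * q1 + 2 * p3 * q2 + 2 * p4 * q1 - 2 * q1 * q4 - 2 * q2 * q3) * (x ^ 5)
          +
      3 * (2 * p3 * p4 - 2 * q3 * q4) * (x ^ 5 * y ^ 2) +
      (-p4 - p3 ^ 2 - 2 * p4 * q1 - 2 * p4 * q2 + 2 * q2 * q4 + q3 ^ 2) * (x ^ 6) +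
      4 * (-p4 ^ 2 + q4 ^ 2) * (x ^ 6 * y ^ 2) +
      (2 * p3 * p4 - 2 * q3 * q4) * (x ^ 7) +
      (-p4 ^ 2 + q4 ^ 2) * (x ^ 8) := by
    rw [hzz]
    simp only [Complex.normSq_apply, pow_succ, pow_zero, one_mul, Complex.add_re, Complex.add_im,
      Complex.mul_re, Complex.mul_im, Complex.one_re, Complex.one_im, Complex.ofReal_re,
      Complex.ofReal_im]
    ring
  rw [key]
  -- With the coefficients turned into nonnegative atoms, every term is visibly nonnegative; `2 * x`
  -- gives strictness.
  generalize -1 / 4 + 2 * p3 - 2 * p4 - q1 - q2 + 2 * q4 + 2 * p3 * q1 - q1 ^ 2 - 2 * q1 * q2 - 2 *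
      q1 * q3 = k0 at c0 ⊢
  generalize p4 - p3 ^ 2 + 2 * p4 * q1 + 2 * p4 * q2 - 2 * q2 * q4 + q3 ^ 2 = k1 at c1 ⊢
  generalize -p4 ^ 2 + q4 ^ 2 = k2 at c2 ⊢
  generalize 1 - 6 * p3 + 3 * q1 + 2 * q2 + 6 * q3 + 2 * q1 ^ 2 = k4 at c4 ⊢
  generalize p3 - 6 * p4 + 2 * p3 * q1 + 2 * p3 * q2 - 6 * p4 * q1 + 6 * q1 * q4 - 2 * q2 * q3 = k5
      at c5 ⊢
  generalize 2 * p3 * p4 - 2 * q3 * q4 = k6 at c6 ⊢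
  generalize -2 - 4 * q1 = k7 at c7 ⊢
  generalize -1 / 2 + 12 * p4 - 2 * q1 - 2 * q2 - 12 * q4 - 2 * q1 ^ 2 - 4 * q1 * q2 = k8 at c8 ⊢
  generalize p4 - 3 * p3 ^ 2 + 2 * p4 * q1 + 2 * p4 * q2 - 2 * q2 * q4 + 3 * q3 ^ 2 = k9 at c9 ⊢
  generalize 1 + 2 * p3 + 3 * q1 + 2 * q2 - 2 * q3 + 2 * q1 ^ 2 = k10 at c10 ⊢
  generalize 2 * p3 - 4 * p4 + 4 * p3 * q1 + 4 * p3 * q2 - 4 * p4 * q1 + 4 * q1 * q4 - 4 * q2 * q3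
      = k11 at c11 ⊢
  generalize -1 / 4 - 2 * p3 - 2 * p4 - q1 - q2 + 2 * q4 - 2 * p3 * q1 - q1 ^ 2 - 2 * q1 * q2 + 2 *
      q1 * q3 = k12 at c12 ⊢
  generalize -p4 - 3 * p3 ^ 2 - 2 * p4 * q1 - 2 * p4 * q2 + 2 * q2 * q4 + 3 * q3 ^ 2 = k13 at c13 ⊢
  generalize p3 + 2 * p4 + 2 * p3 * q1 + 2 * p3 * q2 + 2 * p4 * q1 - 2 * q1 * q4 - 2 * q2 * q3 =
      k14 at c14 ⊢
  generalize -p4 - p3 ^ 2 - 2 * p4 * q1 - 2 * p4 * q2 + 2 * q2 * q4 + q3 ^ 2 = k15 at c15 ⊢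
  positivity


/-- The coefficients of `norm_quartic_lt_of_re_neg` are nonnegative on the box of enclosures. -/
theorem stability_coeffs_nonneg {t u q1 q2 q3 q4 p3 p4 : ℝ} (ht0 : 0 ≤ t) (ht1 : t ≤ 0.3712)
    (hu0 : 0 ≤ u) (hu1 : u ≤ 0.15)
    (h1 : |q1 - (-4.776873 + 1.283213 * t)| ≤ 0.00001)
    (h2 : |q2 - (6.727055 - 2.486089 * t)| ≤ 0.00001)
    (h3 : |q3 - (-3.733226 + 1.573046 * t)| ≤ 0.00001)
    (h4 : |q4 - (0.716706 - 0.323893 * t)| ≤ 0.00001)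
    (h5 : |p3 - (0.769048 + 0.397261 * u - 0.385854 * t - 0.17953 * (t * u))| ≤ 0.00003)
    (h6 : |p4 - (-0.604265 - 0.265974 * u + 0.36726 * t + 0.120199 * (t * u))| ≤ 0.00003) :
    0 ≤ -1 / 4 + 2 * p3 - 2 * p4 - q1 - q2 + 2 * q4 + 2 * p3 * q1 - q1 ^ 2 - 2 * q1 * q2 - 2 * q1 *
        q3 ∧
    0 ≤ p4 - p3 ^ 2 + 2 * p4 * q1 + 2 * p4 * q2 - 2 * q2 * q4 + q3 ^ 2 ∧
    0 ≤ -p4 ^ 2 + q4 ^ 2 ∧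
    0 ≤ 1 - 6 * p3 + 3 * q1 + 2 * q2 + 6 * q3 + 2 * q1 ^ 2 ∧
    0 ≤ p3 - 6 * p4 + 2 * p3 * q1 + 2 * p3 * q2 - 6 * p4 * q1 + 6 * q1 * q4 - 2 * q2 * q3 ∧
    0 ≤ 2 * p3 * p4 - 2 * q3 * q4 ∧
    0 ≤ -2 - 4 * q1 ∧
    0 ≤ -1 / 2 + 12 * p4 - 2 * q1 - 2 * q2 - 12 * q4 - 2 * q1 ^ 2 - 4 * q1 * q2 ∧
    0 ≤ p4 - 3 * p3 ^ 2 + 2 * p4 * q1 + 2 * p4 * q2 - 2 * q2 * q4 + 3 * q3 ^ 2 ∧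
    0 ≤ 1 + 2 * p3 + 3 * q1 + 2 * q2 - 2 * q3 + 2 * q1 ^ 2 ∧
    0 ≤ 2 * p3 - 4 * p4 + 4 * p3 * q1 + 4 * p3 * q2 - 4 * p4 * q1 + 4 * q1 * q4 - 4 * q2 * q3 ∧
    0 ≤ -1 / 4 - 2 * p3 - 2 * p4 - q1 - q2 + 2 * q4 - 2 * p3 * q1 - q1 ^ 2 - 2 * q1 * q2 + 2 * q1 *
        q3 ∧
    0 ≤ -p4 - 3 * p3 ^ 2 - 2 * p4 * q1 - 2 * p4 * q2 + 2 * q2 * q4 + 3 * q3 ^ 2 ∧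
    0 ≤ p3 + 2 * p4 + 2 * p3 * q1 + 2 * p3 * q2 + 2 * p4 * q1 - 2 * q1 * q4 - 2 * q2 * q3 ∧
    0 ≤ -p4 - p3 ^ 2 - 2 * p4 * q1 - 2 * p4 * q2 + 2 * q2 * q4 + q3 ^ 2 := by
  have ha : 0 ≤ 0.3712 - t := sub_nonneg.2 ht1
  have hb : 0 ≤ 0.15 - u := sub_nonneg.2 hu1
  -- At the centres, each claimed quantity is a polynomial of degree at most two in `t` and in `u`.
  -- The nine products `b0`, …, `b8` are, up to scaling, its Bernstein basis on the rectangle, so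
  -- nonnegative Bernstein coefficients that also absorb the error radii certify the sign.
  have b0 : 0 ≤ t ^ 2 * (u ^ 2) := mul_nonneg (pow_nonneg ht0 2) (pow_nonneg hu0 2)
  have b1 : 0 ≤ t ^ 2 * (u * (0.15 - u)) := mul_nonneg (pow_nonneg ht0 2) (mul_nonneg hu0 hb)
  have b2 : 0 ≤ t ^ 2 * ((0.15 - u) ^ 2) := mul_nonneg (pow_nonneg ht0 2) (pow_nonneg hb 2)
  have b3 : 0 ≤ t * (0.3712 - t) * (u ^ 2) := mul_nonneg (mul_nonneg ht0 ha) (pow_nonneg hu0 2)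
  have b4 : 0 ≤ t * (0.3712 - t) * (u * (0.15 - u)) := mul_nonneg (mul_nonneg ht0 ha) (mul_nonneg
      hu0 hb)
  have b5 : 0 ≤ t * (0.3712 - t) * ((0.15 - u) ^ 2) := mul_nonneg (mul_nonneg ht0 ha) (pow_nonneg
      hb 2)
  have b6 : 0 ≤ (0.3712 - t) ^ 2 * (u ^ 2) := mul_nonneg (pow_nonneg ha 2) (pow_nonneg hu0 2)
  have b7 : 0 ≤ (0.3712 - t) ^ 2 * (u * (0.15 - u)) := mul_nonneg (pow_nonneg ha 2) (mul_nonneg hu0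
      hb)
  have b8 : 0 ≤ (0.3712 - t) ^ 2 * ((0.15 - u) ^ 2) := mul_nonneg (pow_nonneg ha 2) (pow_nonneg hb
      2)
  have htu0 : 0 ≤ t * u := mul_nonneg ht0 hu0
  have htu1 : 0 ≤ t * (0.15 - u) := mul_nonneg ht0 hb
  have htu2 : 0 ≤ (0.3712 - t) * u := mul_nonneg ha hu0
  have mq1 : |-4.776873 + 1.283213 * t| ≤ 4.78 := by
    rw [abs_le]; constructor <;> linarith only [ht0, ht1]
  have mq2 : |6.727055 - 2.486089 * t| ≤ 6.73 := by
    rw [abs_le]; constructor <;> linarith only [ht0, ht1]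
  have mq3 : |-3.733226 + 1.573046 * t| ≤ 3.74 := by
    rw [abs_le]; constructor <;> linarith only [ht0, ht1]
  have mq4 : |0.716706 - 0.323893 * t| ≤ 0.72 := by
    rw [abs_le]; constructor <;> linarith only [ht0, ht1]
  have mp3 : |0.769048 + 0.397261 * u - 0.385854 * t - 0.17953 * (t * u)| ≤ 0.9 := by
    rw [abs_le]; constructor <;> linarith only [ht0, ht1, hu0, hu1, htu0, htu1, htu2]
  have mp4 : |-0.604265 - 0.265974 * u + 0.36726 * t + 0.120199 * (t * u)| ≤ 0.7 := by
    rw [abs_le]; constructor <;> linarith only [ht0, ht1, hu0, hu1, htu0, htu1, htu2]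
  -- Here the product of the centres is kept exact (`r = 0`); only the radius of each quadratic
  -- monomial is estimated.
  have hp3p3 : |p3 * p3 - (0.769048 + 0.397261 * u - 0.385854 * t - 0.17953 * (t * u)) * (0.769048
      + 0.397261 * u - 0.385854 * t - 0.17953 * (t * u))| ≤ 56 / 1000000 :=
    near_mul h5 h5 mp3 mp3 (by rw [sub_self, abs_zero]) (by norm_num)
  have hp3p4 : |p3 * p4 - (0.769048 + 0.397261 * u - 0.385854 * t - 0.17953 * (t * u)) * (-0.604265
      - 0.265974 * u + 0.36726 * t + 0.120199 * (t * u))| ≤ 50 / 1000000 :=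
    near_mul h5 h6 mp3 mp4 (by rw [sub_self, abs_zero]) (by norm_num)
  have hp3q1 : |p3 * q1 - (0.769048 + 0.397261 * u - 0.385854 * t - 0.17953 * (t * u)) * (-4.776873
      + 1.283213 * t)| ≤ 154 / 1000000 :=
    near_mul h5 h1 mp3 mq1 (by rw [sub_self, abs_zero]) (by norm_num)
  have hp3q2 : |p3 * q2 - (0.769048 + 0.397261 * u - 0.385854 * t - 0.17953 * (t * u)) * (6.727055
      - 2.486089 * t)| ≤ 212 / 1000000 :=
    near_mul h5 h2 mp3 mq2 (by rw [sub_self, abs_zero]) (by norm_num)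
  have hp4p4 : |p4 * p4 - (-0.604265 - 0.265974 * u + 0.36726 * t + 0.120199 * (t * u)) *
      (-0.604265 - 0.265974 * u + 0.36726 * t + 0.120199 * (t * u))| ≤ 44 / 1000000 :=
    near_mul h6 h6 mp4 mp4 (by rw [sub_self, abs_zero]) (by norm_num)
  have hp4q1 : |p4 * q1 - (-0.604265 - 0.265974 * u + 0.36726 * t + 0.120199 * (t * u)) *
      (-4.776873 + 1.283213 * t)| ≤ 152 / 1000000 :=
    near_mul h6 h1 mp4 mq1 (by rw [sub_self, abs_zero]) (by norm_num)
  have hp4q2 : |p4 * q2 - (-0.604265 - 0.265974 * u + 0.36726 * t + 0.120199 * (t * u)) * (6.727055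
      - 2.486089 * t)| ≤ 210 / 1000000 :=
    near_mul h6 h2 mp4 mq2 (by rw [sub_self, abs_zero]) (by norm_num)
  have hq1q1 : |q1 * q1 - (-4.776873 + 1.283213 * t) * (-4.776873 + 1.283213 * t)| ≤ 97 / 1000000 :=
    near_mul h1 h1 mq1 mq1 (by rw [sub_self, abs_zero]) (by norm_num)
  have hq1q2 : |q1 * q2 - (-4.776873 + 1.283213 * t) * (6.727055 - 2.486089 * t)| ≤ 117 / 1000000 :=
    near_mul h1 h2 mq1 mq2 (by rw [sub_self, abs_zero]) (by norm_num)
  have hq1q3 : |q1 * q3 - (-4.776873 + 1.283213 * t) * (-3.733226 + 1.573046 * t)| ≤ 87 / 1000000 :=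
    near_mul h1 h3 mq1 mq3 (by rw [sub_self, abs_zero]) (by norm_num)
  have hq1q4 : |q1 * q4 - (-4.776873 + 1.283213 * t) * (0.716706 - 0.323893 * t)| ≤ 57 / 1000000 :=
    near_mul h1 h4 mq1 mq4 (by rw [sub_self, abs_zero]) (by norm_num)
  have hq2q3 : |q2 * q3 - (6.727055 - 2.486089 * t) * (-3.733226 + 1.573046 * t)| ≤ 106 / 1000000 :=
    near_mul h2 h3 mq2 mq3 (by rw [sub_self, abs_zero]) (by norm_num)
  have hq2q4 : |q2 * q4 - (6.727055 - 2.486089 * t) * (0.716706 - 0.323893 * t)| ≤ 76 / 1000000 :=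
    near_mul h2 h4 mq2 mq4 (by rw [sub_self, abs_zero]) (by norm_num)
  have hq3q3 : |q3 * q3 - (-3.733226 + 1.573046 * t) * (-3.733226 + 1.573046 * t)| ≤ 76 / 1000000 :=
    near_mul h3 h3 mq3 mq3 (by rw [sub_self, abs_zero]) (by norm_num)
  have hq3q4 : |q3 * q4 - (-3.733226 + 1.573046 * t) * (0.716706 - 0.323893 * t)| ≤ 46 / 1000000 :=
    near_mul h3 h4 mq3 mq4 (by rw [sub_self, abs_zero]) (by norm_num)
  have hq4q4 : |q4 * q4 - (0.716706 - 0.323893 * t) * (0.716706 - 0.323893 * t)| ≤ 16 / 1000000 :=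
    near_mul h4 h4 mq4 mq4 (by rw [sub_self, abs_zero]) (by norm_num)
  obtain ⟨lh1, rh1⟩ := abs_le.1 h1
  obtain ⟨lh2, rh2⟩ := abs_le.1 h2
  obtain ⟨lh3, rh3⟩ := abs_le.1 h3
  obtain ⟨lh4, rh4⟩ := abs_le.1 h4
  obtain ⟨lh5, rh5⟩ := abs_le.1 h5
  obtain ⟨lh6, rh6⟩ := abs_le.1 h6
  obtain ⟨lhp3p3, rhp3p3⟩ := abs_le.1 hp3p3
  obtain ⟨lhp3p4, rhp3p4⟩ := abs_le.1 hp3p4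
  obtain ⟨lhp3q1, rhp3q1⟩ := abs_le.1 hp3q1
  obtain ⟨lhp3q2, rhp3q2⟩ := abs_le.1 hp3q2
  obtain ⟨lhp4p4, rhp4p4⟩ := abs_le.1 hp4p4
  obtain ⟨lhp4q1, rhp4q1⟩ := abs_le.1 hp4q1
  obtain ⟨lhp4q2, rhp4q2⟩ := abs_le.1 hp4q2
  obtain ⟨lhq1q1, rhq1q1⟩ := abs_le.1 hq1q1
  obtain ⟨lhq1q2, rhq1q2⟩ := abs_le.1 hq1q2
  obtain ⟨lhq1q3, rhq1q3⟩ := abs_le.1 hq1q3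
  obtain ⟨lhq1q4, rhq1q4⟩ := abs_le.1 hq1q4
  obtain ⟨lhq2q3, rhq2q3⟩ := abs_le.1 hq2q3
  obtain ⟨lhq2q4, rhq2q4⟩ := abs_le.1 hq2q4
  obtain ⟨lhq3q3, rhq3q3⟩ := abs_le.1 hq3q3
  obtain ⟨lhq3q4, rhq3q4⟩ := abs_le.1 hq3q4
  obtain ⟨lhq4q4, rhq4q4⟩ := abs_le.1 hq4q4
  refine ⟨?_, ?_, ?_, ?_, ?_, ?_, ?_, ?_, ?_, ?_, ?_, ?_, ?_, ?_, ?_⟩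
  · linarith only [b0, b1, b2, b3, b4, b5, b6, b7, b8, lh4, rhq1q3, rh6, rhq1q2, rh2, rhq1q1, rh1,
      lhp3q1, lh5]
  · linarith only [b0, b1, b2, b3, b4, b5, b6, b7, b8, rhq2q4, lhq3q3, lhp4q2, lhp4q1, lh6, rhp3p3]
  · linarith only [b0, b1, b2, b3, b4, b5, b6, b7, b8, lhq4q4, rhp4p4]
  · linarith only [b0, b1, b2, b3, b4, b5, b6, b7, b8, lh3, rh5, lh2, lhq1q1, lh1]
  · linarith only [b0, b1, b2, b3, b4, b5, b6, b7, b8, lhq1q4, rhq2q3, rhp4q1, rh6, lhp3q2, lhp3q1,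
      lh5]
  · linarith only [b0, b1, b2, b3, b4, b5, b6, b7, b8, rhq3q4, lhp3p4]
  · linarith only [b0, b1, b2, b3, b4, b5, b6, b7, b8, rh1]
  · linarith only [b0, b1, b2, b3, b4, b5, b6, b7, b8, rh4, lh6, rhq1q2, rh2, rhq1q1, rh1]
  · linarith only [b0, b1, b2, b3, b4, b5, b6, b7, b8, rhq2q4, lhq3q3, lhp4q2, lhp4q1, lh6, rhp3p3]
  · linarith only [b0, b1, b2, b3, b4, b5, b6, b7, b8, rh3, lh5, lhq1q1, lh1, lh2]
  · linarith only [b0, b1, b2, b3, b4, b5, b6, b7, b8, lhq1q4, rhq2q3, rhp4q1, rh6, lhp3q2, lhp3q1,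
      lh5]
  · linarith only [b0, b1, b2, b3, b4, b5, b6, b7, b8, lh4, lhq1q3, rh6, rhp3q1, rh5, rhq1q2, rh2,
      rhq1q1, rh1]
  · linarith only [b0, b1, b2, b3, b4, b5, b6, b7, b8, lhq2q4, lhq3q3, rhp4q2, rhp4q1, rh6, rhp3p3]
  · linarith only [b0, b1, b2, b3, b4, b5, b6, b7, b8, rhq1q4, rhq2q3, lhp4q1, lh6, lhp3q2, lhp3q1,
      lh5]
  · linarith only [b0, b1, b2, b3, b4, b5, b6, b7, b8, lhq2q4, lhq3q3, rhp4q2, rhp4q1, rh6, rhp3p3]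


/-- The stability function of the scheme has modulus less than one in the open left half-plane. -/
theorem SSPMPRK3Coeffs.IsSSPMPRK3.norm_stability_lt_one {P : SSPMPRK3Coeffs} {η₂ : ℝ}
    (hP : P.IsSSPMPRK3 η₂) (hη : η₂ ∈ Set.Icc (0 : ℝ) 0.37110619221712509)
    {z Y1 ρ Y2 a σ T : ℂ} (hz : z.re < 0)
    (h1 : Y1 = 1 + P.β10 * (z * Y1))
    (hρ : ρ = (P.n1 + 2 * P.n2) * Y1 - P.n2)
    (h2 : Y2 = P.α20 + P.α21 * Y1 + z * (P.β20 + P.β21 * Y1 + (P.β20 + P.β21) * (Y2 - ρ)))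
    (h3 : a = P.η1 + P.η2 * Y1 + z * ((P.η1 + P.η2) * (P.η3 + P.η4 * Y1) +
      (P.η3 + P.η4) * (a - (P.η1 + P.η2) * ((1 - P.s) + P.s * Y1))))
    (hσ : σ = a + P.ζ * (1 + Y2 - ρ))
    (h4 : T = P.α30 + P.α31 * Y1 + P.α32 * Y2 + z * (P.β30 + P.β31 * Y1 + P.β32 * Y2 +
      (P.β30 + P.β31 + P.β32) * (T - σ))) : ‖T‖ < 1 := by
  have hT := hP.den_mul_eq_num h1 hρ h2 h3 hσ h4
  have ht0 := hη.1
  have ht1 : η₂ ≤ 0.3712 := hη.2.trans (by norm_num)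
  have hs := hP.s_mem
  have hu0 : 0 ≤ P.s - 5.6 := sub_nonneg.2 hs.1
  have hu1 : P.s - 5.6 ≤ 0.15 := by linarith [hs.2]
  obtain ⟨e1, e2, e3, e4, e5, e6⟩ := hP.enclosure ht0 ht1 hu0 hu1 (by ring)
  obtain ⟨c0, c1, c2, c4, c5, c6, c7, c8, c9, c10, c11, c12, c13, c14, c15⟩ :=
    stability_coeffs_nonneg ht0 ht1 hu0 hu1 e1 e2 e3 e4 e5 e6
  have hlt := norm_quartic_lt_of_re_neg c0 c1 c2 c4 c5 c6 c7 c8 c9 c10 c11 c12 c13 c14 c15 hz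
  rw [← hT, norm_mul] at hlt
  -- The strict inequality `‖D‖ * ‖T‖ < ‖D‖` already excludes `‖T‖ ≥ 1`; nonvanishing of the
  -- denominator `D` need not be shown separately.
  by_contra! hge
  nlinarith [norm_nonneg (1 + P.den1 * z + P.den2 * z ^ 2 + P.den3 * z ^ 3 + P.den4 * z ^ 4 : ℂ)]

/-! ### Derivatives of the stages as matrices -/

section derivative

variable {ι : Type*} [Fintype ι] [DecidableEq ι]

/-- Multiplication by a matrix as a continuous linear map. -/
noncomputable def Matrix.mulVecCLM (M : Matrix ι ι ℝ) : (ι → ℝ) →L[ℝ] (ι → ℝ) :=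
  M.mulVecLin.toContinuousLinearMap

omit [DecidableEq ι] in
@[simp]
theorem Matrix.mulVecCLM_apply (M : Matrix ι ι ℝ) (v : ι → ℝ) : M.mulVecCLM v = M.mulVec v := rfl

theorem Matrix.mulVecCLM_pow (M : Matrix ι ι ℝ) (k : ℕ) :
    M.mulVecCLM ^ k = (M ^ k).mulVecCLM := by
  induction k with
  | zero => ext1 v; simp
  | succ k ih =>
    ext1 v
    rw [pow_succ, ih, mul_apply_eq_comp]
    simp [pow_succ]

omit [DecidableEq ι] in
theorem hasStrictFDerivAt_mulVecCLM_iff {f : (ι → ℝ) → ι → ℝ} {F : Matrix ι ι ℝ} {x : ι → ℝ} :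
    HasStrictFDerivAt f F.mulVecCLM x ↔
      ∀ i, HasStrictFDerivAt (fun y => f y i)
        ((ContinuousLinearMap.proj (R := ℝ) (φ := fun _ : ι => ℝ) i).comp F.mulVecCLM) x :=
  hasStrictFDerivAt_pi'

theorem hasStrictFDerivAt_id_mulVecCLM (x : ι → ℝ) :
    HasStrictFDerivAt (fun y : ι → ℝ => y) (1 : Matrix ι ι ℝ).mulVecCLM x := by
  have h : (1 : Matrix ι ι ℝ).mulVecCLM = ContinuousLinearMap.id ℝ (ι → ℝ) := by ext1 v; simp
  rw [h]
  exact hasStrictFDerivAt_id x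

omit [DecidableEq ι] in
theorem HasStrictFDerivAt.mulVecCLM_add {f h : (ι → ℝ) → ι → ℝ} {F H : Matrix ι ι ℝ} {x : ι → ℝ}
    (hf : HasStrictFDerivAt f F.mulVecCLM x) (hh : HasStrictFDerivAt h H.mulVecCLM x) :
    HasStrictFDerivAt (fun y => f y + h y) (F + H).mulVecCLM x := by
  convert! hf.add hh using 1
  ext1 v; simp [Matrix.add_mulVec]

omit [DecidableEq ι] in
theorem HasStrictFDerivAt.mulVecCLM_const_smul {f : (ι → ℝ) → ι → ℝ} {F : Matrix ι ι ℝ}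
    {x : ι → ℝ} (c : ℝ) (hf : HasStrictFDerivAt f F.mulVecCLM x) :
    HasStrictFDerivAt (fun y => c • f y) (c • F).mulVecCLM x := by
  convert! hf.const_smul c using 1
  ext1 v; simp [Matrix.smul_mulVec]

-- Where `f = c • h`, the quotient rule collapses to the single matrix `F - c • H` with row `i`
-- divided by `h x i`. These row factors disappear later, when the weight is multiplied by a
-- solution proportional to `h x`.
omit [DecidableEq ι] in
theorem HasStrictFDerivAt.mulVecCLM_div {f h : (ι → ℝ) → ι → ℝ} {F H : Matrix ι ι ℝ} {x : ι → ℝ}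
    {c : ℝ} (hf : HasStrictFDerivAt f F.mulVecCLM x) (hh : HasStrictFDerivAt h H.mulVecCLM x)
    (hc : f x = c • h x) (h0 : ∀ i, h x i ≠ 0) (i : ι) :
    HasStrictFDerivAt (fun y => f y i / h y i)
      ((h x i)⁻¹ • (ContinuousLinearMap.proj (R := ℝ) (φ := fun _ : ι => ℝ) i).comp
        (F - c • H).mulVecCLM) x := by
  have h1 := hasStrictFDerivAt_mulVecCLM_iff.1 hf i
  have h2 := hasStrictFDerivAt_mulVecCLM_iff.1 hh i
  have h3 := h1.mul ((hasStrictDerivAt_inv (h0 i)).comp_hasStrictFDerivAt x h2)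
  have hci : f x i = c * h x i := by rw [hc]; rfl
  convert! h3 using 1
  ext1 v
  have := h0 i
  simp [Matrix.sub_mulVec, Matrix.smul_mulVec, hci]
  field_simp
  ring

/-- The geometric mean `y ^ (1 - s) * h ^ s` at a point where `h x = x`. -/
theorem HasStrictFDerivAt.mulVecCLM_rpow {h : (ι → ℝ) → ι → ℝ}
    {H : Matrix ι ι ℝ} {x : ι → ℝ} (s : ℝ) (hh : HasStrictFDerivAt h H.mulVecCLM x) (hx : h x = x)
    (h0 : ∀ i, 0 < x i) :
    HasStrictFDerivAt (fun y i => y i ^ (1 - s) * h y i ^ s)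
      ((1 - s) • (1 : Matrix ι ι ℝ) + s • H).mulVecCLM x := by
  rw [hasStrictFDerivAt_mulVecCLM_iff]
  intro i
  have h1 := hasStrictFDerivAt_mulVecCLM_iff.1 (hasStrictFDerivAt_id_mulVecCLM x) i
  have h2 := hasStrictFDerivAt_mulVecCLM_iff.1 hh i
  have hxi : h x i = x i := congrFun hx i
  have e1 := (Real.hasStrictDerivAt_rpow_const_of_ne (h0 i).ne' (1 - s)).comp_hasStrictFDerivAt x h1
  have e2 := (Real.hasStrictDerivAt_rpow_const_of_ne (hxi ▸ (h0 i).ne' : h x i ≠ 0)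
    s).comp_hasStrictFDerivAt x h2
  convert! e1.mul e2 using 1
  ext1 v
  simp [Matrix.add_mulVec, Matrix.smul_mulVec, hxi]
  have p1 : x i ^ (1 - s) * x i ^ (s - 1) = 1 := by
    rw [← Real.rpow_add (h0 i)]; simp
  have p2 : x i ^ s * x i ^ (-s) = 1 := by
    rw [← Real.rpow_add (h0 i)]; simp
  linear_combination (-(s * H.mulVec v i)) * p1 - (1 - s) * v i * p2

omit [DecidableEq ι] in
/-- The derivative of `f * (h / k)` at a common fixed point of `f`, `h` and `k`. -/
theorem HasStrictFDerivAt.mulVecCLM_mul_div {f h k : (ι → ℝ) → ι → ℝ} {F H K : Matrix ι ι ℝ}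
    {x : ι → ℝ} (hf : HasStrictFDerivAt f F.mulVecCLM x) (hh : HasStrictFDerivAt h H.mulVecCLM x)
    (hk : HasStrictFDerivAt k K.mulVecCLM x) (hfx : f x = x) (hhx : h x = x) (hkx : k x = x)
    (h0 : ∀ i, x i ≠ 0) :
    HasStrictFDerivAt (fun y i => f y i * (h y i / k y i)) (F + (H - K)).mulVecCLM x := by
  rw [hasStrictFDerivAt_mulVecCLM_iff]
  intro i
  have h1 := hasStrictFDerivAt_mulVecCLM_iff.1 hf i
  have h2 := hh.mulVecCLM_div (c := 1) hk (by rw [hhx, hkx, one_smul]) (by rwa [hkx]) i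
  convert! h1.mul h2 using 1
  ext1 v
  have := h0 i
  simp [Matrix.add_mulVec, Matrix.sub_mulVec, hfx, hhx, hkx]
  field_simp
  ring

/-- At `x` the weight is the constant `c` and the solution is `m • h x`, so the row factors `1 / h x
i` cancel and implicit differentiation reads `(1 - c • Z) u' = B + m • (Z * (F - c • H))`. No
diagonal matrix survives, which is why the derivative stays in the commutant of whatever commutes
with `Z`. -/
theorem hasStrictFDerivAt_patankarSolve_div {Z : Matrix ι ι ℝ} {f h b : (ι → ℝ) → ι → ℝ}
    {F H B : Matrix ι ι ℝ} {x : ι → ℝ} {c m : ℝ} (hf : HasStrictFDerivAt f F.mulVecCLM x)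
    (hh : HasStrictFDerivAt h H.mulVecCLM x) (hb : HasStrictFDerivAt b B.mulVecCLM x)
    (hc : f x = c • h x) (h0 : ∀ i, h x i ≠ 0) (hu : patankarSolve Z (f x / h x) (b x) = m • h x)
    (hdet : (1 - c • Z).det ≠ 0) :
    HasStrictFDerivAt (fun y => patankarSolve Z (f y / h y) (b y))
      ((1 - c • Z)⁻¹ * (B + m • (Z * (F - c • H)))).mulVecCLM x := by
  have hD0 : f x / h x = fun _ => c := by
    ext i; simp [hc, h0 i]
  have hdiag : Z * Matrix.diagonal (f x / h x) = c • Z := by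
    rw [hD0]; ext i j; simp [mul_comm]
  have hD := hasStrictFDerivAt_pi.2 fun i => hf.mulVecCLM_div hh hc h0 i
  obtain ⟨u', hu', hv⟩ := exists_hasStrictFDerivAt_patankarSolve (A := Z) (D := fun y => f y / h y)
    hD hb (by rwa [hdiag])
  convert! hu' using 1
  ext1 v
  have h1 := hv v
  have h2 : (1 - c • Z).mulVec (u' v) = (B + m • (Z * (F - c • H))).mulVec v := by
    rw [Matrix.sub_mulVec, Matrix.one_mulVec, sub_eq_iff_eq_add]
    rw [Matrix.mulVec_add, hu, hD0] at h1
    refine h1.trans ?_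
    rw [Matrix.add_mulVec, Matrix.smul_mulVec, Matrix.smul_mulVec, ← Matrix.mulVec_mulVec,
      add_assoc, add_comm (m • _), ← Matrix.mulVec_smul, ← Matrix.mulVec_smul]
    congr 2
    · congr 1
      ext i
      have := h0 i
      simp
      field_simp
  rw [Matrix.mulVecCLM_apply, ← Matrix.mulVec_mulVec, ← h2, Matrix.mulVec_mulVec,
    Matrix.nonsing_inv_mul _ (isUnit_iff_ne_zero.2 hdet), Matrix.one_mulVec]

/-- The derivative `J` of a Patankar stage is characterized by differentiating its equation, and it
commutes with everything that commutes with the data. -/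
theorem exists_hasStrictFDerivAt_patankarSolve_div {Z : Matrix ι ι ℝ} {f h b : (ι → ℝ) → ι → ℝ}
    {F H B : Matrix ι ι ℝ} {x : ι → ℝ} {c m : ℝ} (hf : HasStrictFDerivAt f F.mulVecCLM x)
    (hh : HasStrictFDerivAt h H.mulVecCLM x) (hb : HasStrictFDerivAt b B.mulVecCLM x)
    (hc : f x = c • h x) (h0 : ∀ i, h x i ≠ 0) (hu : patankarSolve Z (f x / h x) (b x) = m • h x)
    (hdet : (1 - c • Z).det ≠ 0) :
    ∃ J : Matrix ι ι ℝ, HasStrictFDerivAt (fun y => patankarSolve Z (f y / h y) (b y))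
        J.mulVecCLM x ∧ J = B + m • (Z * (F - c • H)) + c • (Z * J) ∧
      ∀ M, Commute M Z → Commute M F → Commute M H → Commute M B → Commute M J := by
  have hu' : IsUnit (1 - c • Z).det := isUnit_iff_ne_zero.2 hdet
  refine ⟨_, hasStrictFDerivAt_patankarSolve_div hf hh hb hc h0 hu hdet, ?_, ?_⟩
  · set X := B + m • (Z * (F - c • H))
    have h1 : (1 - c • Z) * ((1 - c • Z)⁻¹ * X) = X := by
      rw [← mul_assoc, Matrix.mul_nonsing_inv _ hu', one_mul]
    rw [sub_mul, one_mul, smul_mul_assoc, sub_eq_iff_eq_add] at h1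
    exact h1
  · intro M hZ hF hH hB
    have h1 : Commute M (1 - c • Z) := (Commute.one_right M).sub_right (hZ.smul_right c)
    have h2 : Commute M (1 - c • Z)⁻¹ := by
      rw [commute_iff_eq]
      calc M * (1 - c • Z)⁻¹ = (1 - c • Z)⁻¹ * ((1 - c • Z) * M) * (1 - c • Z)⁻¹ := by
            rw [← mul_assoc, Matrix.nonsing_inv_mul _ hu', one_mul]
        _ = (1 - c • Z)⁻¹ * M := by
            rw [← h1.eq, mul_assoc, mul_assoc, Matrix.mul_nonsing_inv _ hu', mul_one]
    exact h2.mul_right (hB.add_right ((hZ.mul_right (hF.sub_right (hH.smul_right c))).smul_right m))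

end derivative

/-! ### Reduction to scalars on eigenvectors -/

section eigenvector

variable {ι : Type*} [Fintype ι] {w : ι → ℂ} {M M' Z J X : Matrix ι ι ℝ} {μ ν : ℂ}

/-- The complex vector `w` is mapped to `μ • w` by the real matrix `M`. -/
def Matrix.ActsBy (M : Matrix ι ι ℝ) (w : ι → ℂ) (μ : ℂ) : Prop :=
  (M.map Complex.ofReal).mulVec w = μ • w

theorem Matrix.ActsBy.add (h : M.ActsBy w μ) (h' : M'.ActsBy w ν) :
    (M + M').ActsBy w (μ + ν) := by
  unfold Matrix.ActsBy at *
  rw [Matrix.map_add _ Complex.ofReal_add, Matrix.add_mulVec, h, h', add_smul]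

theorem Matrix.ActsBy.sub (h : M.ActsBy w μ) (h' : M'.ActsBy w ν) :
    (M - M').ActsBy w (μ - ν) := by
  unfold Matrix.ActsBy at *
  rw [Matrix.map_sub _ Complex.ofReal_sub, Matrix.sub_mulVec, h, h', sub_smul]

theorem Matrix.ActsBy.smul (h : M.ActsBy w μ) (c : ℝ) : (c • M).ActsBy w (c * μ) := by
  unfold Matrix.ActsBy at *
  have : (c • M).map Complex.ofReal = (c : ℂ) • M.map Complex.ofReal := by ext; simp
  rw [this, Matrix.smul_mulVec, h, smul_smul]

theorem Matrix.ActsBy.mul (h : M.ActsBy w μ) (h' : M'.ActsBy w ν) :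
    (M * M').ActsBy w (μ * ν) := by
  unfold Matrix.ActsBy at *
  have : (M * M').map Complex.ofReal = M.map Complex.ofReal * M'.map Complex.ofReal :=
    Matrix.map_mul (f := Complex.ofRealHom)
  rw [this, ← Matrix.mulVec_mulVec, h', Matrix.mulVec_smul, h, smul_smul, mul_comm]

theorem Matrix.ActsBy.one [DecidableEq ι] : (1 : Matrix ι ι ℝ).ActsBy w 1 := by
  unfold Matrix.ActsBy
  rw [Matrix.map_one _ Complex.ofReal_zero Complex.ofReal_one, Matrix.one_mulVec, one_smul]

/-- Solutions of `J = X + c Z J` that commute with `Z` act on eigenvectors of `Z`. -/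
theorem Matrix.ActsBy.exists_of_eq (hZ : Z.ActsBy w μ) (hX : X.ActsBy w ν) {c : ℝ}
    (hJ : J = X + c • (Z * J)) (hcomm : Commute J Z) (hc : 1 - c * μ ≠ 0) :
    ∃ j : ℂ, J.ActsBy w j ∧ j = ν + c * (μ * j) := by
  have h1 : (J.map Complex.ofReal).mulVec w = ν • w + (c * μ) • (J.map Complex.ofReal).mulVec
      w := by
    -- Commutation replaces `Z * J` by `J * Z`, so that `Z` meets its eigenvector and the equation
    -- becomes `(1 - c μ) J w = ν w`.
    have e : J.map Complex.ofReal = X.map Complex.ofReal +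
        (c : ℂ) • (J.map Complex.ofReal * Z.map Complex.ofReal) := by
      have : (J * Z).map Complex.ofReal = J.map Complex.ofReal * Z.map Complex.ofReal :=
        Matrix.map_mul (f := Complex.ofRealHom)
      rw [← this, hcomm.eq]
      conv_lhs => rw [hJ]
      ext; simp
    conv_lhs => rw [e]
    rw [Matrix.add_mulVec, hX, Matrix.smul_mulVec, ← Matrix.mulVec_mulVec, hZ, Matrix.mulVec_smul,
      smul_smul]
  refine ⟨ν / (1 - c * μ), ?_, by field_simp; ring⟩
  have h2 : (1 - c * μ) • (J.map Complex.ofReal).mulVec w = ν • w := by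
    rw [sub_smul, one_smul, sub_eq_iff_eq_add]; exact h1
  unfold Matrix.ActsBy
  rw [div_eq_inv_mul, mul_smul, ← h2, smul_smul, inv_mul_cancel₀ hc, one_smul]

end eigenvector


/-! ### Production-destruction form of a linear system -/

section linear

variable {ι : Type*} [Fintype ι] [DecidableEq ι] {A : Matrix ι ι ℝ}

/-- The destruction sum is `y i * w i` times the off-diagonal sum of column `i`, which is `-A i i`.
It supplies the diagonal term that the production sum omits. -/
theorem sum_linProd_sub_sum_linDest (hA : A.IsConservativeMetzler) (y w : ι → ℝ) (i : ι) :
    ∑ j, linProd A y i j * w j - ∑ j, linDest A y i j * w i = A.mulVec (y * w) i := by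
  have h1 : ∀ j, linProd A y i j * w j = A i j * (y j * w j) -
      if i = j then A i i * (y i * w i) else 0 := fun j => by
    unfold linProd; split_ifs with h
    · subst h; ring
    · ring
  have h2 : ∀ j, linDest A y i j * w i = A j i * (y i * w i) -
      if i = j then A i i * (y i * w i) else 0 := fun j => by
    unfold linDest linProd
    by_cases h : i = j
    · subst h; simp
    · rw [if_neg h, if_neg (Ne.symm h)]; ring
  simp only [h1, h2, Finset.sum_sub_distrib, ← Finset.sum_mul, hA.col_sum]
  simp [Matrix.mulVec, dotProduct]

omit [Fintype ι] in
theorem linProd_add_smul (c c' : ℝ) (y y' : ι → ℝ) (i j : ι) :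
    c * linProd A y i j + c' * linProd A y' i j = linProd A (c • y + c' • y') i j := by
  unfold linProd
  split_ifs
  · simp
  · simp; ring

omit [Fintype ι] in
theorem linDest_add_smul (c c' : ℝ) (y y' : ι → ℝ) (i j : ι) :
    c * linDest A y i j + c' * linDest A y' i j = linDest A (c • y + c' • y') i j :=
  linProd_add_smul c c' y y' j i

omit [Fintype ι] in
theorem linProd_smul (c : ℝ) (y : ι → ℝ) (i j : ι) :
    c * linProd A y i j = linProd A (c • y) i j := by
  unfold linProd
  split_ifs
  · simp
  · simp; ring

omit [Fintype ι] in
theorem linDest_smul (c : ℝ) (y : ι → ℝ) (i j : ι) :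
    c * linDest A y i j = linDest A (c • y) i j :=
  linProd_smul c y j i

/-- A Patankar stage is a linear system. -/
theorem patankar_stage_iff (hA : A.IsConservativeMetzler) {Δt : ℝ} (ht : 0 ≤ Δt)
    {f h u b : ι → ℝ} (hf : ∀ i, 0 ≤ f i / h i) :
    (∀ i, u i = b i + Δt * (∑ j, linProd A f i j * (u j / h j) -
      ∑ j, linDest A f i j * (u i / h i))) ↔ u = patankarSolve (Δt • A) (f / h) b := by
  rw [patankarSolve_unique ((hA.smul ht).det_one_sub_ne_zero (D := f / h) hf), funext_iff]
  refine forall_congr' fun i => ?_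
  rw [sum_linProd_sub_sum_linDest hA f (fun j => u j / h j) i, Pi.add_apply, Matrix.smul_mulVec,
    Pi.smul_apply, smul_eq_mul]
  have : f * (fun j => u j / h j) = f / h * u := by
    ext j; simp; ring
  rw [this]

theorem patankarSolve_fixed {Z : Matrix ι ι ℝ} (hZ : Z.IsConservativeMetzler) {f h u : ι → ℝ}
    {c : ℝ} (hc : 0 ≤ c) (hf : f = c • h) (hh : ∀ i, h i ≠ 0) (hu : Z.mulVec u = 0) :
    patankarSolve Z (f / h) u = u := by
  have h1 : f / h = fun _ => c := by ext i; simp [hf, hh i]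
  symm
  rw [h1, patankarSolve_unique (hZ.det_one_sub_ne_zero fun _ => hc)]
  have : (fun _ => c) * u = c • u := by ext; simp
  rw [this, Matrix.mulVec_smul, hu, smul_zero, add_zero]

end linear

/-! ### The step map: positivity, steady states, invariants, linearization -/

namespace SSPMPRK3Coeffs

section stages

variable {ι : Type*} [Fintype ι] [DecidableEq ι] (P : SSPMPRK3Coeffs) (Z : Matrix ι ι ℝ)

/-- First stage of the scheme for a linear system, `Z` being the matrix times the step size. -/
noncomputable def stage1 (y : ι → ℝ) : ι → ℝ := patankarSolve Z (P.β10 • y / y) y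

/-- The weight `ρ`. -/
noncomputable def rho (y : ι → ℝ) : ι → ℝ :=
  P.n1 • P.stage1 Z y + P.n2 • fun i => P.stage1 Z y i * (P.stage1 Z y i / y i)

/-- Second stage. -/
noncomputable def stage2 (y : ι → ℝ) : ι → ℝ :=
  patankarSolve Z ((P.β20 • y + P.β21 • P.stage1 Z y) / P.rho Z y)
    (P.α20 • y + P.α21 • P.stage1 Z y)

/-- The weight of the auxiliary stage. -/
noncomputable def auxWeight (y : ι → ℝ) : ι → ℝ :=
  fun i => y i ^ (1 - P.s) * P.stage1 Z y i ^ P.s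

/-- The auxiliary stage `a`. -/
noncomputable def aux (y : ι → ℝ) : ι → ℝ :=
  patankarSolve Z ((P.η3 • y + P.η4 • P.stage1 Z y) / P.auxWeight Z y)
    (P.η1 • y + P.η2 • P.stage1 Z y)

/-- The weight `σ`. -/
noncomputable def sigma (y : ι → ℝ) : ι → ℝ :=
  P.aux Z y + P.ζ • fun i => y i * (P.stage2 Z y i / P.rho Z y i)

/-- The step map. -/
noncomputable def step (y : ι → ℝ) : ι → ℝ :=
  patankarSolve Z ((P.β30 • y + P.β31 • P.stage1 Z y + P.β32 • P.stage2 Z y) / P.sigma Z y)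
    (P.α30 • y + P.α31 • P.stage1 Z y + P.α32 • P.stage2 Z y)

end stages

namespace IsSSPMPRK3

variable {P : SSPMPRK3Coeffs} {η₂ : ℝ}

theorem β10_pos (hP : P.IsSSPMPRK3 η₂) : 0 < P.β10 := by linarith [(abs_le.1 hP.β10_near).1]
theorem α20_pos (hP : P.IsSSPMPRK3 η₂) : 0 < P.α20 := by linarith [(abs_le.1 hP.α20_near).1]
theorem α21_pos (hP : P.IsSSPMPRK3 η₂) : 0 < P.α21 := by linarith [(abs_le.1 hP.α21_near).1]
theorem α30_pos (hP : P.IsSSPMPRK3 η₂) : 0 < P.α30 := by linarith [(abs_le.1 hP.α30_near).1]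
theorem α31_pos (hP : P.IsSSPMPRK3 η₂) : 0 < P.α31 := by linarith [(abs_le.1 hP.α31_near).1]
theorem α32_pos (hP : P.IsSSPMPRK3 η₂) : 0 < P.α32 := by linarith [(abs_le.1 hP.α32_near).1]
theorem β20_pos (hP : P.IsSSPMPRK3 η₂) : 0 < P.β20 := by linarith [(abs_le.1 hP.β20_near).1]
theorem β21_pos (hP : P.IsSSPMPRK3 η₂) : 0 < P.β21 := by linarith [(abs_le.1 hP.β21_near).1]
theorem β30_pos (hP : P.IsSSPMPRK3 η₂) : 0 < P.β30 := by linarith [(abs_le.1 hP.β30_near).1]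
theorem β31_pos (hP : P.IsSSPMPRK3 η₂) : 0 < P.β31 := by linarith [(abs_le.1 hP.β31_near).1]
theorem β32_pos (hP : P.IsSSPMPRK3 η₂) : 0 < P.β32 := by linarith [(abs_le.1 hP.β32_near).1]
theorem ζ_pos (hP : P.IsSSPMPRK3 η₂) : 0 < P.ζ := by linarith [(abs_le.1 hP.ζ_near).1]
theorem n1_pos (hP : P.IsSSPMPRK3 η₂) : 0 < P.n1 := by linarith [(abs_le.1 hP.n1_near).1]
theorem n2_pos (hP : P.IsSSPMPRK3 η₂) : 0 < P.n2 := by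
  linarith [(abs_le.1 hP.n1_near).2, hP.n_sum]
theorem η12_pos (hP : P.IsSSPMPRK3 η₂) : 0 < P.η1 + P.η2 := by
  linarith [(abs_le.1 hP.ζ_near).2, hP.η_sum]
-- `η3` is, up to the tolerance, decreasing in `η₂`, and it is still about `0.138` at the right end
-- of the interval.
theorem η3_pos (hP : P.IsSSPMPRK3 η₂) (h : η₂ ≤ 0.37110619221712509) : 0 < P.η3 := by
  linarith [(abs_le.1 hP.η3_near).1]
theorem η4_pos (hP : P.IsSSPMPRK3 η₂) : 0 < P.η4 := by linarith [(abs_le.1 hP.η4_near).1]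

variable {ι : Type*} [Fintype ι] [DecidableEq ι] {Z : Matrix ι ι ℝ} {y : ι → ℝ}

theorem stage1_pos (hP : P.IsSSPMPRK3 η₂) (hZ : Z.IsConservativeMetzler) (hy : ∀ i, 0 < y i)
    (i : ι) : 0 < P.stage1 Z y i :=
  patankarSolve_pos hZ (fun i => div_nonneg (mul_nonneg hP.β10_pos.le (hy i).le) (hy i).le) hy i

theorem rho_pos (hP : P.IsSSPMPRK3 η₂) (hZ : Z.IsConservativeMetzler) (hy : ∀ i, 0 < y i)
    (i : ι) : 0 < P.rho Z y i := by
  have h1 := hP.stage1_pos hZ hy i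
  have h2 := hy i
  have h3 := hP.n1_pos
  have h4 := hP.n2_pos
  simp only [rho, Pi.add_apply, Pi.smul_apply, smul_eq_mul]
  positivity

theorem stage2_weight_nonneg (hP : P.IsSSPMPRK3 η₂) (hZ : Z.IsConservativeMetzler)
    (hy : ∀ i, 0 < y i) (i : ι) :
    0 ≤ (P.β20 • y + P.β21 • P.stage1 Z y) i / P.rho Z y i := by
  have h1 := hP.stage1_pos hZ hy i
  have h2 := hy i
  have h3 := hP.β20_pos
  have h4 := hP.β21_pos
  have h5 := hP.rho_pos hZ hy i
  simp only [Pi.add_apply, Pi.smul_apply, smul_eq_mul]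
  positivity

theorem stage2_pos (hP : P.IsSSPMPRK3 η₂) (hZ : Z.IsConservativeMetzler) (hy : ∀ i, 0 < y i)
    (i : ι) : 0 < P.stage2 Z y i := by
  refine patankarSolve_pos hZ (hP.stage2_weight_nonneg hZ hy) (fun i => ?_) i
  have h1 := hP.stage1_pos hZ hy i
  have h2 := hy i
  have h3 := hP.α20_pos
  have h4 := hP.α21_pos
  simp only [Pi.add_apply, Pi.smul_apply, smul_eq_mul]
  positivity

theorem auxWeight_pos (hP : P.IsSSPMPRK3 η₂) (hZ : Z.IsConservativeMetzler) (hy : ∀ i, 0 < y i)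
    (i : ι) : 0 < P.auxWeight Z y i :=
  mul_pos (Real.rpow_pos_of_pos (hy i) _) (Real.rpow_pos_of_pos (hP.stage1_pos hZ hy i) _)

theorem aux_weight_nonneg (hP : P.IsSSPMPRK3 η₂) (hη : η₂ ∈ Set.Icc (0 : ℝ) 0.37110619221712509)
    (hZ : Z.IsConservativeMetzler) (hy : ∀ i, 0 < y i) (i : ι) :
    0 ≤ (P.η3 • y + P.η4 • P.stage1 Z y) i / P.auxWeight Z y i := by
  have h1 := hP.stage1_pos hZ hy i
  have h2 := hy i
  have h3 := hP.η3_pos hη.2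
  have h4 := hP.η4_pos
  have h5 := hP.auxWeight_pos hZ hy i
  simp only [Pi.add_apply, Pi.smul_apply, smul_eq_mul]
  positivity

theorem aux_pos (hP : P.IsSSPMPRK3 η₂) (hη : η₂ ∈ Set.Icc (0 : ℝ) 0.37110619221712509)
    (hZ : Z.IsConservativeMetzler) (hy : ∀ i, 0 < y i) (i : ι) : 0 < P.aux Z y i := by
  refine patankarSolve_pos hZ (hP.aux_weight_nonneg hη hZ hy) (fun i => ?_) i
  have h1 := hP.stage1_pos hZ hy i
  have h2 := hy i
  have h3 := hP.η1_nonneg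
  have h4 : 0 ≤ P.η2 := hP.η2_eq ▸ hη.1
  have h5 := hP.η12_pos
  simp only [Pi.add_apply, Pi.smul_apply, smul_eq_mul]
  -- Either of `η1` and `η2` may vanish, but not both, as their sum is positive.
  rcases h4.eq_or_lt with h | h
  · rw [← h, add_zero] at h5
    rw [← h]
    positivity
  · positivity

theorem sigma_pos (hP : P.IsSSPMPRK3 η₂) (hη : η₂ ∈ Set.Icc (0 : ℝ) 0.37110619221712509)
    (hZ : Z.IsConservativeMetzler) (hy : ∀ i, 0 < y i) (i : ι) : 0 < P.sigma Z y i := by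
  have h1 := hP.aux_pos hη hZ hy i
  have h2 := hP.stage2_pos hZ hy i
  have h3 := hP.rho_pos hZ hy i
  have h4 := hP.ζ_pos
  have h5 := hy i
  simp only [sigma, Pi.add_apply, Pi.smul_apply, smul_eq_mul]
  positivity

theorem step_weight_nonneg (hP : P.IsSSPMPRK3 η₂) (hη : η₂ ∈ Set.Icc (0 : ℝ) 0.37110619221712509)
    (hZ : Z.IsConservativeMetzler) (hy : ∀ i, 0 < y i) (i : ι) :
    0 ≤ (P.β30 • y + P.β31 • P.stage1 Z y + P.β32 • P.stage2 Z y) i / P.sigma Z y i := by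
  have h1 := hP.stage1_pos hZ hy i
  have h2 := hP.stage2_pos hZ hy i
  have h3 := hP.sigma_pos hη hZ hy i
  have h4 := hP.β30_pos
  have h5 := hP.β31_pos
  have h6 := hP.β32_pos
  have h7 := hy i
  simp only [Pi.add_apply, Pi.smul_apply, smul_eq_mul]
  positivity

theorem step_pos (hP : P.IsSSPMPRK3 η₂) (hη : η₂ ∈ Set.Icc (0 : ℝ) 0.37110619221712509)
    (hZ : Z.IsConservativeMetzler) (hy : ∀ i, 0 < y i) (i : ι) : 0 < P.step Z y i := by
  refine patankarSolve_pos hZ (hP.step_weight_nonneg hη hZ hy) (fun i => ?_) i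
  have h1 := hP.stage1_pos hZ hy i
  have h2 := hP.stage2_pos hZ hy i
  have h4 := hP.α30_pos
  have h5 := hP.α31_pos
  have h6 := hP.α32_pos
  have h7 := hy i
  simp only [Pi.add_apply, Pi.smul_apply, smul_eq_mul]
  positivity

/-- The equations are triangular: once the earlier vectors are known, each one determines the next,
either explicitly or through a uniquely solvable linear system. -/
theorem isStep_iff {A : Matrix ι ι ℝ} {Δt : ℝ} {z : ι → ℝ} (hP : P.IsSSPMPRK3 η₂)
    (hη : η₂ ∈ Set.Icc (0 : ℝ) 0.37110619221712509) (hA : A.IsConservativeMetzler)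
    (ht : 0 < Δt) (hy : ∀ i, 0 < y i) :
    P.IsStep (linProd A) (linDest A) Δt y z ↔ z = P.step (Δt • A) y := by
  have hZ := hA.smul ht.le
  have e1 : ∀ y1 : ι → ℝ, (∀ i, y1 i = P.α10 * y i + P.β10 * Δt *
      (∑ j, linProd A y i j * (y1 j / y j) - ∑ j, linDest A y i j * (y1 i / y i))) ↔
      y1 = P.stage1 (Δt • A) y := by
    intro y1
    rw [stage1, ← patankar_stage_iff (f := P.β10 • y) (h := y) hA ht.le
      (fun i => div_nonneg (mul_nonneg hP.β10_pos.le (hy i).le) (hy i).le)]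
    refine forall_congr' fun i => ?_
    simp only [← linProd_smul, ← linDest_smul, hP.α10_eq, one_mul, mul_assoc, ← Finset.mul_sum]
    rw [← mul_sub, mul_left_comm]
  have eρ : ∀ ρ : ι → ℝ, (∀ i, ρ i = P.n1 * P.stage1 (Δt • A) y i +
      P.n2 * y i * (P.stage1 (Δt • A) y i / y i) ^ 2) ↔ ρ = P.rho (Δt • A) y := by
    intro ρ
    rw [funext_iff]
    refine forall_congr' fun i => ?_
    have := (hy i).ne'
    have h : P.n2 * y i * (P.stage1 (Δt • A) y i / y i) ^ 2 =
        P.n2 * (P.stage1 (Δt • A) y i * (P.stage1 (Δt • A) y i / y i)) := by field_simp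
    rw [h]
    rfl
  have e2 : ∀ u : ι → ℝ, (∀ i, u i = P.α20 * y i + P.α21 * P.stage1 (Δt • A) y i + Δt *
      (∑ j, (P.β20 * linProd A y i j + P.β21 * linProd A (P.stage1 (Δt • A) y) i j) *
          (u j / P.rho (Δt • A) y j) -
        ∑ j, (P.β20 * linDest A y i j + P.β21 * linDest A (P.stage1 (Δt • A) y) i j) *
          (u i / P.rho (Δt • A) y i))) ↔ u = P.stage2 (Δt • A) y := by
    intro u
    simp only [linProd_add_smul, linDest_add_smul]
    exact patankar_stage_iff hA ht.le (hP.stage2_weight_nonneg hZ hy)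
  have e3 : ∀ u : ι → ℝ, (∀ i, u i = P.η1 * y i + P.η2 * P.stage1 (Δt • A) y i + Δt *
      (∑ j, (P.η3 * linProd A y i j + P.η4 * linProd A (P.stage1 (Δt • A) y) i j) *
          (u j / (y j ^ (1 - P.s) * P.stage1 (Δt • A) y j ^ P.s)) -
        ∑ j, (P.η3 * linDest A y i j + P.η4 * linDest A (P.stage1 (Δt • A) y) i j) *
          (u i / (y i ^ (1 - P.s) * P.stage1 (Δt • A) y i ^ P.s)))) ↔
      u = P.aux (Δt • A) y := by
    intro u
    simp only [linProd_add_smul, linDest_add_smul]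
    exact patankar_stage_iff hA ht.le (hP.aux_weight_nonneg hη hZ hy)
  have eσ : ∀ σ : ι → ℝ, (∀ i, σ i = P.aux (Δt • A) y i +
      P.ζ * y i * (P.stage2 (Δt • A) y i / P.rho (Δt • A) y i)) ↔ σ = P.sigma (Δt • A) y := by
    intro σ
    rw [funext_iff]
    refine forall_congr' fun i => ?_
    rw [mul_assoc]
    rfl
  have e4 : ∀ u : ι → ℝ, (∀ i, u i = P.α30 * y i + P.α31 * P.stage1 (Δt • A) y i +
      P.α32 * P.stage2 (Δt • A) y i + Δt *
      (∑ j, (P.β30 * linProd A y i j + P.β31 * linProd A (P.stage1 (Δt • A) y) i j +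
          P.β32 * linProd A (P.stage2 (Δt • A) y) i j) * (u j / P.sigma (Δt • A) y j) -
        ∑ j, (P.β30 * linDest A y i j + P.β31 * linDest A (P.stage1 (Δt • A) y) i j +
          P.β32 * linDest A (P.stage2 (Δt • A) y) i j) * (u i / P.sigma (Δt • A) y i))) ↔
      u = P.step (Δt • A) y := by
    intro u
    have h1 : ∀ y y' y'' : ι → ℝ, ∀ i j, P.β30 * linProd A y i j + P.β31 * linProd A y' i j +
        P.β32 * linProd A y'' i j = linProd A (P.β30 • y + P.β31 • y' + P.β32 • y'') i j := by
      intro y y' y'' i j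
      rw [linProd_add_smul, ← one_mul (linProd A (_ + _) i j), linProd_add_smul, one_smul]
    have h2 : ∀ y y' y'' : ι → ℝ, ∀ i j, P.β30 * linDest A y i j + P.β31 * linDest A y' i j +
        P.β32 * linDest A y'' i j = linDest A (P.β30 • y + P.β31 • y' + P.β32 • y'') i j :=
      fun y y' y'' i j => h1 y y' y'' j i
    simp only [h1, h2]
    exact patankar_stage_iff hA ht.le (hP.step_weight_nonneg hη hZ hy)
  constructor
  · rintro ⟨y1, ρ, y2, a, σ, h1, h2, h3, h4, h5, h6⟩
    obtain rfl := (e1 y1).1 h1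
    obtain rfl := (eρ ρ).1 h2
    obtain rfl := (e2 y2).1 h3
    obtain rfl := (e3 a).1 h4
    obtain rfl := (eσ σ).1 h5
    exact (e4 z).1 h6
  · rintro rfl
    exact ⟨_, _, _, _, _, (e1 _).2 rfl, (eρ _).2 rfl, (e2 _).2 rfl, (e3 _).2 rfl, (eσ _).2 rfl,
      (e4 _).2 rfl⟩


/-- Positive steady states are fixed by all stages and by the step. -/
theorem stages_eq_of_steady (hP : P.IsSSPMPRK3 η₂)
    (hη : η₂ ∈ Set.Icc (0 : ℝ) 0.37110619221712509) (hZ : Z.IsConservativeMetzler)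
    (hy : ∀ i, 0 < y i) (h : Z.mulVec y = 0) :
    P.stage1 Z y = y ∧ P.rho Z y = y ∧ P.stage2 Z y = y ∧ P.auxWeight Z y = y ∧
      P.aux Z y = (P.η1 + P.η2) • y ∧ P.sigma Z y = y ∧ P.step Z y = y := by
  have hne : ∀ i, y i ≠ 0 := fun i => (hy i).ne'
  have h1 : P.stage1 Z y = y := patankarSolve_fixed hZ hP.β10_pos.le rfl hne h
  have h2 : P.rho Z y = y := by
    ext i
    simp only [rho, h1, Pi.add_apply, Pi.smul_apply, smul_eq_mul, div_self (hne i), mul_one,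
      ← add_mul, hP.n_sum, one_mul]
  have h3 : P.stage2 Z y = y := by
    rw [stage2, h1, h2, ← add_smul, ← add_smul, hP.α2_sum, one_smul]
    exact patankarSolve_fixed hZ (add_pos hP.β20_pos hP.β21_pos).le rfl hne h
  have h4 : P.auxWeight Z y = y := by
    ext i
    rw [auxWeight, h1, ← Real.rpow_add (hy i), sub_add_cancel, Real.rpow_one]
  -- The weights of `a` sum to `1 - ζ` only; the `ζ` term of `σ` supplies the rest.
  have h5 : P.aux Z y = (P.η1 + P.η2) • y := by
    rw [aux, h1, h4, ← add_smul, ← add_smul]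
    have e : (P.η3 + P.η4) • y / y = (P.η3 + P.η4) • ((P.η1 + P.η2) • y) / ((P.η1 + P.η2) • y) := by
      ext i
      have := hne i
      have := hP.η12_pos.ne'
      simp only [Pi.div_apply, Pi.smul_apply, smul_eq_mul]
      field_simp
    rw [e]
    refine patankarSolve_fixed hZ (add_pos (hP.η3_pos hη.2) hP.η4_pos).le rfl
      (fun i => mul_ne_zero hP.η12_pos.ne' (hne i)) ?_
    rw [Matrix.mulVec_smul, h, smul_zero]
  have h6 : P.sigma Z y = y := by
    ext i
    simp only [sigma, h2, h3, h5, Pi.add_apply, Pi.smul_apply, smul_eq_mul, div_self (hne i),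
      mul_one, ← add_mul, hP.η_sum, one_mul]
  refine ⟨h1, h2, h3, h4, h5, h6, ?_⟩
  rw [step, h1, h3, h6, ← add_smul, ← add_smul, ← add_smul, ← add_smul, hP.α3_sum, one_smul]
  exact patankarSolve_fixed hZ (add_pos (add_pos hP.β30_pos hP.β31_pos) hP.β32_pos).le rfl hne h

/-- The solution differs from `b` by a vector in the range of `Z`, which `Q` annihilates. -/
theorem mulVec_patankarSolve {Q : Matrix ι ι ℝ} {D b : ι → ℝ}
    (hZ : Z.IsConservativeMetzler) (hQZ : Q * Z = 0) (hD : ∀ i, 0 ≤ D i) :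
    Q.mulVec (patankarSolve Z D b) = Q.mulVec b := by
  conv_lhs => rw [patankarSolve_eq (hZ.det_one_sub_ne_zero hD)]
  rw [Matrix.mulVec_add, Matrix.mulVec_mulVec, hQZ, Matrix.zero_mulVec, add_zero]

/-- Linear invariants of the system are preserved by the step. -/
theorem mulVec_step (hP : P.IsSSPMPRK3 η₂) (hη : η₂ ∈ Set.Icc (0 : ℝ) 0.37110619221712509)
    (hZ : Z.IsConservativeMetzler) {Q : Matrix ι ι ℝ} (hQZ : Q * Z = 0) (hy : ∀ i, 0 < y i) :
    Q.mulVec (P.step Z y) = Q.mulVec y := by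
  have h1 : Q.mulVec (P.stage1 Z y) = Q.mulVec y := mulVec_patankarSolve hZ hQZ
    fun i => div_nonneg (mul_nonneg hP.β10_pos.le (hy i).le) (hy i).le
  have h2 : Q.mulVec (P.stage2 Z y) = Q.mulVec y := by
    refine (mulVec_patankarSolve hZ hQZ (hP.stage2_weight_nonneg hZ hy)).trans ?_
    rw [Matrix.mulVec_add, Matrix.mulVec_smul, Matrix.mulVec_smul, h1, ← add_smul, hP.α2_sum,
      one_smul]
  refine (mulVec_patankarSolve hZ hQZ (hP.step_weight_nonneg hη hZ hy)).trans ?_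
  rw [Matrix.mulVec_add, Matrix.mulVec_add, Matrix.mulVec_smul, Matrix.mulVec_smul,
    Matrix.mulVec_smul, h1, h2, ← add_smul, ← add_smul, hP.α3_sum, one_smul]

/-- The linearization of the step at a positive steady state: it commutes with everything that
commutes with `Z`, and acts with modulus less than one on the eigenvectors of `Z` whose eigenvalue
lies in the open left half-plane. -/
theorem exists_hasStrictFDerivAt_step (hP : P.IsSSPMPRK3 η₂)
    (hη : η₂ ∈ Set.Icc (0 : ℝ) 0.37110619221712509) (hZ : Z.IsConservativeMetzler)
    (hy : ∀ i, 0 < y i) (h : Z.mulVec y = 0) :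
    ∃ T : Matrix ι ι ℝ, HasStrictFDerivAt (P.step Z) T.mulVecCLM y ∧
      (∀ M, Commute M Z → Commute M T) ∧
      ∀ (μ : ℂ) (w : ι → ℂ), μ.re < 0 → Z.ActsBy w μ → ∃ τ : ℂ, ‖τ‖ < 1 ∧ T.ActsBy w τ := by
  have hne : ∀ i, y i ≠ 0 := fun i => (hy i).ne'
  obtain ⟨s1, sρ, s2, sw, sa, sσ, sT⟩ := hP.stages_eq_of_steady hη hZ hy h
  have hdet : ∀ {c : ℝ}, 0 < c → (1 - c • Z).det ≠ 0 := fun {c} hc => by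
    have : Z * Matrix.diagonal (fun _ => c) = c • Z := by ext i j; simp [mul_comm]
    rw [← this]
    exact hZ.det_one_sub_ne_zero fun _ => hc.le
  have hw2 : 0 < P.β20 + P.β21 := add_pos hP.β20_pos hP.β21_pos
  have hw3 : 0 < P.η3 + P.η4 := add_pos (hP.η3_pos hη.2) hP.η4_pos
  have hw4 : 0 < P.β30 + P.β31 + P.β32 := add_pos (add_pos hP.β30_pos hP.β31_pos) hP.β32_pos
  have d0 := hasStrictFDerivAt_id_mulVecCLM y
  obtain ⟨J1, d1, j1, k1⟩ := exists_hasStrictFDerivAt_patankarSolve_div (Z := Z) (m := 1)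
    (d0.mulVecCLM_const_smul P.β10) d0 d0 rfl hne (by rw [one_smul]; exact s1) (hdet hP.β10_pos)
  replace d1 : HasStrictFDerivAt (P.stage1 Z) J1.mulVecCLM y := d1
  have dρ : HasStrictFDerivAt (P.rho Z) _ y := (d1.mulVecCLM_const_smul P.n1).mulVecCLM_add
    ((d1.mulVecCLM_mul_div d1 d0 s1 s1 rfl hne).mulVecCLM_const_smul P.n2)
  have dw : HasStrictFDerivAt (P.auxWeight Z) _ y := d1.mulVecCLM_rpow P.s s1 hy
  obtain ⟨J2, d2, j2, k2⟩ := exists_hasStrictFDerivAt_patankarSolve_div (Z := Z) (m := 1)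
    (c := P.β20 + P.β21)
    ((d0.mulVecCLM_const_smul P.β20).mulVecCLM_add (d1.mulVecCLM_const_smul P.β21)) dρ
    ((d0.mulVecCLM_const_smul P.α20).mulVecCLM_add (d1.mulVecCLM_const_smul P.α21))
    (by rw [s1, sρ, add_smul]) (by rwa [sρ]) (by rw [one_smul]; exact s2.trans sρ.symm) (hdet hw2)
  replace d2 : HasStrictFDerivAt (P.stage2 Z) J2.mulVecCLM y := d2
  -- Unlike in the other stages, `m ≠ 1`: at the steady state the weight equals `y` while `a` equals
  -- `(η1 + η2) • y`.
  obtain ⟨Ja, da, ja, ka⟩ := exists_hasStrictFDerivAt_patankarSolve_div (Z := Z)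
    (m := P.η1 + P.η2) (c := P.η3 + P.η4)
    ((d0.mulVecCLM_const_smul P.η3).mulVecCLM_add (d1.mulVecCLM_const_smul P.η4)) dw
    ((d0.mulVecCLM_const_smul P.η1).mulVecCLM_add (d1.mulVecCLM_const_smul P.η2))
    (by rw [s1, sw, add_smul]) (by rwa [sw]) (sa.trans (by rw [sw])) (hdet hw3)
  replace da : HasStrictFDerivAt (P.aux Z) Ja.mulVecCLM y := da
  have dσ : HasStrictFDerivAt (P.sigma Z) _ y := da.mulVecCLM_add
    ((d0.mulVecCLM_mul_div d2 dρ rfl s2 sρ hne).mulVecCLM_const_smul P.ζ)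
  obtain ⟨T, dT, jT, kT⟩ := exists_hasStrictFDerivAt_patankarSolve_div (Z := Z) (m := 1)
    (c := P.β30 + P.β31 + P.β32)
    (((d0.mulVecCLM_const_smul P.β30).mulVecCLM_add
      (d1.mulVecCLM_const_smul P.β31)).mulVecCLM_add (d2.mulVecCLM_const_smul P.β32)) dσ
    (((d0.mulVecCLM_const_smul P.α30).mulVecCLM_add
      (d1.mulVecCLM_const_smul P.α31)).mulVecCLM_add (d2.mulVecCLM_const_smul P.α32))
    (by rw [s1, s2, sσ, add_smul, add_smul]) (by rwa [sσ])
    (by rw [one_smul]; exact sT.trans sσ.symm) (hdet hw4)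
  -- everything commutes
  have o : ∀ M : Matrix ι ι ℝ, Commute M 1 := Commute.one_right
  have c1 : ∀ M, Commute M Z → Commute M J1 := fun M hM =>
    k1 M hM ((o M).smul_right _) (o M) (o M)
  have cρ : ∀ M, Commute M Z → Commute M (P.n1 • J1 + P.n2 • (J1 + (J1 - 1))) := fun M hM =>
    ((c1 M hM).smul_right _).add_right
      (((c1 M hM).add_right ((c1 M hM).sub_right (o M))).smul_right _)
  have c2 : ∀ M, Commute M Z → Commute M J2 := fun M hM =>
    k2 M hM (((o M).smul_right _).add_right ((c1 M hM).smul_right _)) (cρ M hM)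
      (((o M).smul_right _).add_right ((c1 M hM).smul_right _))
  have ca : ∀ M, Commute M Z → Commute M Ja := fun M hM =>
    ka M hM (((o M).smul_right _).add_right ((c1 M hM).smul_right _))
      (((o M).smul_right _).add_right ((c1 M hM).smul_right _))
      (((o M).smul_right _).add_right ((c1 M hM).smul_right _))
  have cT : ∀ M, Commute M Z → Commute M T := fun M hM =>
    kT M hM ((((o M).smul_right _).add_right ((c1 M hM).smul_right _)).add_right
        ((c2 M hM).smul_right _))
      ((ca M hM).add_right (((o M).add_right ((c2 M hM).sub_right (cρ M hM))).smul_right _))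
      ((((o M).smul_right _).add_right ((c1 M hM).smul_right _)).add_right
        ((c2 M hM).smul_right _))
  refine ⟨T, dT, cT, fun μ w hμ hw => ?_⟩
  have hc : ∀ {c : ℝ}, 0 < c → (1 - c * μ : ℂ) ≠ 0 := fun {c} hc h0 => by
    have := congrArg Complex.re h0
    simp at this
    nlinarith
  have I : (1 : Matrix ι ι ℝ).ActsBy w 1 := Matrix.ActsBy.one
  have comm : ∀ {J : Matrix ι ι ℝ}, (∀ M, Commute M Z → Commute M J) → Commute J Z :=
    fun hJ => (hJ Z (Commute.refl Z)).symm
  -- On `w` all the derivative matrices become scalars, and their defining equations become the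
  -- scalar scheme behind the stability function. Each is solvable since `1 - c μ` has positive real
  -- part. In this first stage the weight `β10 • y / y` is constant, hence the cancelling pair.
  obtain ⟨y1, a1, e1⟩ := hw.exists_of_eq
    (I.add ((hw.mul ((I.smul P.β10).sub (I.smul P.β10))).smul 1)) j1 (comm c1) (hc hP.β10_pos)
  have aρ := (a1.smul P.n1).add ((a1.add (a1.sub I)).smul P.n2)
  obtain ⟨y2, a2, e2⟩ := hw.exists_of_eq (((I.smul P.α20).add (a1.smul P.α21)).add
    ((hw.mul (((I.smul P.β20).add (a1.smul P.β21)).sub (aρ.smul (P.β20 + P.β21)))).smul 1))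
    j2 (comm c2) (hc hw2)
  obtain ⟨ya, aa, ea⟩ := hw.exists_of_eq (((I.smul P.η1).add (a1.smul P.η2)).add
    ((hw.mul (((I.smul P.η3).add (a1.smul P.η4)).sub
      (((I.smul (1 - P.s)).add (a1.smul P.s)).smul (P.η3 + P.η4)))).smul (P.η1 + P.η2)))
    ja (comm ca) (hc hw3)
  have aσ := aa.add ((I.add (a2.sub aρ)).smul P.ζ)
  obtain ⟨τ, aT, eT⟩ := hw.exists_of_eq
    ((((I.smul P.α30).add (a1.smul P.α31)).add (a2.smul P.α32)).add
      ((hw.mul ((((I.smul P.β30).add (a1.smul P.β31)).add (a2.smul P.β32)).sub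
        (aσ.smul (P.β30 + P.β31 + P.β32)))).smul 1)) jT (comm cT) (hc hw4)
  push_cast at e1 e2 ea eT
  refine ⟨τ, hP.norm_stability_lt_one hη hμ (Y1 := y1)
    (ρ := P.n1 * y1 + P.n2 * (y1 + (y1 - 1))) (Y2 := y2) (a := ya)
    (σ := ya + P.ζ * (1 + (y2 - (P.n1 * y1 + P.n2 * (y1 + (y1 - 1)))))) ?_ ?_ ?_ ?_ ?_ ?_, aT⟩
  · linear_combination e1
  · ring
  · linear_combination e2
  · linear_combination ea
  · ring
  · linear_combination eT

end IsSSPMPRK3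

end SSPMPRK3Coeffs

theorem mainTheorem5 {N : ℕ} (A : Matrix (Fin N) (Fin N) ℝ)
    (hMetzler : ∀ i j, i ≠ j → 0 ≤ A i j)
    (hcons : Matrix.mulVec A.transpose 1 = 0)
    (ystar : Fin N → ℝ) (hpos : ∀ i, 0 < ystar i) (hsteady : Matrix.mulVec A ystar = 0)
    (Δt : ℝ) (hΔt : 0 < Δt)
    (η₂ : ℝ) (hη₂ : η₂ ∈ Set.Icc (0 : ℝ) 0.37110619221712509)
    (P : SSPMPRK3Coeffs) (hP : P.IsSSPMPRK3 η₂) :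
    ∃ g : (Fin N → ℝ) → (Fin N → ℝ),
      (∀ y : Fin N → ℝ, (∀ i, 0 < y i) →
        (∀ i, 0 < g y i) ∧ ∀ z, P.IsStep (linProd A) (linDest A) Δt y z ↔ z = g y) ∧
      IsLyapunovStableFixedPt {y : Fin N → ℝ | ∀ i, 0 < y i} g ystar := by
  have hA : A.IsConservativeMetzler := ⟨hMetzler, fun j => by
    simpa [Matrix.mulVec, dotProduct] using congrFun hcons j⟩
  set Z := Δt • A with hZdef
  have hZ : Z.IsConservativeMetzler := hA.smul hΔt.le
  have hZy : Z.mulVec ystar = 0 := by rw [hZdef, Matrix.smul_mulVec, hsteady, smul_zero]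
  refine ⟨P.step Z, fun y hy => ⟨hP.step_pos hη₂ hZ hy, fun z => hP.isStep_iff hη₂ hA hΔt hy⟩, ?_⟩
  -- `Q * Z = 0` makes `Q y` an invariant of the step; `Z * Q = 0` makes the vectors fixed by `Q`
  -- steady states. Both together let `Q` commute with `Z`, hence with the linearization.
  obtain ⟨Q, hQ, hZQ, hQZ⟩ := Matrix.exists_projection_ker (A := Z) fun u hu =>
    hZ.mulVec_eq_zero_of_mulVec_mulVec_eq_zero hpos hZy hu
  obtain ⟨T, hT, hcomm, heig⟩ := hP.exists_hasStrictFDerivAt_step hη₂ hZ hpos hZy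
  obtain ⟨k, hk⟩ := hZ.exists_pow_contraction hQ hZQ hQZ (hcomm Z (Commute.refl Z)).symm
    (hcomm Q (by rw [commute_iff_eq, hZQ, hQZ])).symm fun μ w _ hμ hw => heig μ w hμ hw
  refine IsLyapunovStableFixedPt.of_hasStrictFDerivAt (T := T.mulVecCLM) (Q := Q.mulVecCLM)
    (k := k) ?_ (fun y hy => hP.step_pos hη₂ hZ hy) hT (hQ _ hZy) (fun y => hQ _ ?_)
    (fun y hy => hP.mulVec_step hη₂ hZ hQZ hy) (fun y hy hQy => ?_) fun v hv => ?_
  · have hopen : IsOpen {y : Fin N → ℝ | ∀ i, 0 < y i} := by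
      simp only [Set.ofPred_forall]
      exact isOpen_iInter_of_finite fun i => isOpen_lt continuous_const (continuous_apply i)
    exact hopen.mem_nhds hpos
  · rw [Matrix.mulVecCLM_apply, Matrix.mulVec_mulVec, hZQ, Matrix.zero_mulVec]
  -- If `Q y = y`, then `Z y = Z Q y = 0`, so `y` is itself a positive steady state.
  · refine (hP.stages_eq_of_steady hη₂ hZ hy ?_).2.2.2.2.2.2
    rw [← hQy, Matrix.mulVecCLM_apply, Matrix.mulVec_mulVec, hZQ, Matrix.zero_mulVec]
  · rw [Matrix.mulVecCLM_pow]
    exact hk v hv
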